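/- Let $k$ be a field. For a finite-dimensional $k$-algebra $B$, a finite-dimensional right $B$-module $M$ is called exceptional if $\operatorname{End}_B(M)=k$ and $\operatorname{Ext}^n_B(M,M)=0$ for all $n>0$. The one-point extension and the one-point coextension of $B$ by $M$ are the matrix algebras $$B[M]=\begin{pmatrix} B & 0\\ M & k\end{pmatrix},\qquad [M]B=\begin{pmatrix} k & 0\\ DM & B\end{pmatrix},\qquad DM=\operatorname{Hom}_k(M,k).$$ A finite-dimensional $k$-algebra $A$ is called accessible if there are finite-dimensional $k$-algebras $A_1,\dots,A_n$ with $A_1\cong k$ and $A_n\cong A$ such that, for each $1\le s<n$, the algebra $A_{s+1}$ is isomorphic to a one-point extension or a one-point coextension of $A_s$ by an exceptional $A_s$-module. A tree algebra over $k$ is a quotient $k[\vec\Delta]/I$, where $\vec\Delta$ is a finite quiver whose underlying graph is a (nonempty) tree and $I$ is the two-sided ideal of the path algebra $k[\vec\Delta]$ generated by an arbitrary set of paths of length at least $2$ (zero relations). Proposition. Each tree algebra is accessible. -/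

import Mathlib

open CategoryTheory

universe u v w

/-! ## Path algebras of finite quivers -/

/-- The path algebra `k[Q]` of a finite quiver `Q` with vertex set `V`.  An element is a finite
`k`-linear combination of paths, stored as the family of its parts supported on the paths
from `a` to `b`, for all vertices `a` and `b`. -/
def PathAlgebra (k : Type u) [Field k] (V : Type v) [Quiver.{w} V] : Type (max u v w) :=
  ∀ a b : V, Quiver.Path a b →₀ k

namespace PathAlgebra

variable {k : Type u} [Field k] {V : Type v} [Quiver.{w} V]

noncomputable instance : AddCommGroup (PathAlgebra k V) :=
  inferInstanceAs (AddCommGroup (∀ a b : V, Quiver.Path a b →₀ k))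

noncomputable instance : Module k (PathAlgebra k V) :=
  inferInstanceAs (Module k (∀ a b : V, Quiver.Path a b →₀ k))

/-- The bilinear extension of the concatenation of paths. -/
noncomputable def concat (a b c : V) :
    (Quiver.Path a b →₀ k) →ₗ[k] (Quiver.Path b c →₀ k) →ₗ[k] (Quiver.Path a c →₀ k) :=
  Finsupp.linearCombination k fun p : Quiver.Path a b =>
    Finsupp.lmapDomain k k fun q : Quiver.Path b c => p.comp q

theorem concat_single (a b c : V) (p : Quiver.Path a b) (q : Quiver.Path b c) (r s : k) :
    concat a b c (Finsupp.single p r) (Finsupp.single q s)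
      = Finsupp.single (p.comp q) (r * s) := by
  simp [concat]

theorem concat_assoc (a b c d : V) (x : Quiver.Path a b →₀ k) (y : Quiver.Path b c →₀ k)
    (z : Quiver.Path c d →₀ k) :
    concat a c d (concat a b c x y) z = concat a b d x (concat b c d y z) := by
  induction x using Finsupp.induction_linear with
  | zero => simp
  | add x₁ x₂ h₁ h₂ => simp [h₁, h₂]
  | single p r =>
    induction y using Finsupp.induction_linear with
    | zero => simp
    | add y₁ y₂ h₁ h₂ => simp [h₁, h₂]
    | single q s =>
      induction z using Finsupp.induction_linear with
      | zero => simp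
      | add z₁ z₂ h₁ h₂ => simp [h₁, h₂]
      | single t e => simp only [concat_single, Quiver.Path.comp_assoc, mul_assoc]

theorem nil_concat (a b : V) (x : Quiver.Path a b →₀ k) :
    concat a a b (Finsupp.single Quiver.Path.nil 1) x = x := by
  induction x using Finsupp.induction_linear with
  | zero => simp
  | add x₁ x₂ h₁ h₂ => rw [map_add, h₁, h₂]
  | single p r => simp [concat_single]

theorem concat_nil (a b : V) (x : Quiver.Path a b →₀ k) :
    concat a b b x (Finsupp.single Quiver.Path.nil 1) = x := by
  induction x using Finsupp.induction_linear with
  | zero => simp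
  | add x₁ x₂ h₁ h₂ => rw [map_add, LinearMap.add_apply, h₁, h₂]
  | single p r => simp [concat_single]

variable [Fintype V] [DecidableEq V]

/-- The product of two paths is their concatenation if the first ends where the second starts,
and zero otherwise; the unit is the sum of the trivial paths. -/
noncomputable instance : Ring (PathAlgebra k V) :=
  { (inferInstance : AddCommGroup (PathAlgebra k V)) with
    mul := fun x y a c => ∑ b, concat a b c (x a b) (y b c)
    one := fun a => Pi.single a (Finsupp.single Quiver.Path.nil 1)
    mul_assoc := fun x y z => by
      funext a d
      change ∑ c, concat a c d (∑ b, concat a b c (x a b) (y b c)) (z c d)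
        = ∑ b, concat a b d (x a b) (∑ c, concat b c d (y b c) (z c d))
      simp only [map_sum, LinearMap.sum_apply, concat_assoc]
      exact Finset.sum_comm
    one_mul := fun x => by
      funext a c
      change ∑ b, concat a b c (Pi.single
        (M := fun b : V => Quiver.Path a b →₀ k) a (Finsupp.single Quiver.Path.nil 1) b) (x b c)
        = x a c
      rw [Finset.sum_eq_single a]
      · rw [Pi.single_eq_same, nil_concat]
      · intro b _ hb
        rw [Pi.single_eq_of_ne hb]
        simp
      · simp
    mul_one := fun x => by
      funext a c
      change ∑ b, concat a b c (x a b) (Pi.single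
        (M := fun d : V => Quiver.Path b d →₀ k) b (Finsupp.single Quiver.Path.nil 1) c) = x a c
      rw [Finset.sum_eq_single c]
      · rw [Pi.single_eq_same, concat_nil]
      · intro b _ hb
        rw [Pi.single_eq_of_ne hb.symm]
        simp
      · simp
    left_distrib := fun x y z => by
      funext a c
      change ∑ b, concat a b c (x a b) (y b c + z b c)
        = ∑ b, concat a b c (x a b) (y b c) + ∑ b, concat a b c (x a b) (z b c)
      simp [Finset.sum_add_distrib]
    right_distrib := fun x y z => by
      funext a c
      change ∑ b, concat a b c (x a b + y a b) (z b c)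
        = ∑ b, concat a b c (x a b) (z b c) + ∑ b, concat a b c (y a b) (z b c)
      simp [Finset.sum_add_distrib]
    zero_mul := fun x => by
      funext a c
      change ∑ b, concat a b c 0 (x b c) = 0
      simp
    mul_zero := fun x => by
      funext a c
      change ∑ b, concat a b c (x a b) 0 = 0
      simp }

theorem mul_apply (x y : PathAlgebra k V) (a c : V) :
    (x * y) a c = ∑ b, concat a b c (x a b) (y b c) := rfl

theorem one_apply (a : V) :
    (1 : PathAlgebra k V) a = Pi.single a (Finsupp.single Quiver.Path.nil 1) := rfl

noncomputable instance : Algebra k (PathAlgebra k V) :=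
  Algebra.ofModule
    (fun r x y => by
      funext a c
      change ∑ b, concat a b c (r • x a b) (y b c) = r • ∑ b, concat a b c (x a b) (y b c)
      simp [Finset.smul_sum])
    (fun r x y => by
      funext a c
      change ∑ b, concat a b c (x a b) (r • y b c) = r • ∑ b, concat a b c (x a b) (y b c)
      simp [Finset.smul_sum])

/-- The basis element of the path algebra given by a path. -/
noncomputable def ofPath (k : Type u) [Field k] {a b : V} (p : Quiver.Path a b) :
    PathAlgebra k V :=
  Pi.single a (Pi.single b (Finsupp.single p 1))

end PathAlgebra

/-! ## Tree algebras -/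

/-- The underlying graph of the quiver `V` (one edge for each arrow) is a tree: there are no
loops, any two vertices are joined by at most one arrow (in either direction), and the simple
graph that results from forgetting the orientation is a tree. -/
structure IsTreeQuiver (V : Type v) [Quiver.{w} V] : Prop where
  subsingleton_hom : ∀ a b : V, Subsingleton (a ⟶ b)
  not_both : ∀ a b : V, Nonempty (a ⟶ b) → ¬ Nonempty (b ⟶ a)
  isTree : (SimpleGraph.fromRel fun a b : V => Nonempty (a ⟶ b)).IsTree

/-- The ideal of the path algebra generated by a set `R` of paths. -/
noncomputable def zeroRelationIdeal (k : Type u) [Field k] {V : Type v} [Quiver.{w} V]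
    [Fintype V] [DecidableEq V] (R : ∀ a b : V, Set (Quiver.Path a b)) :
    TwoSidedIdeal (PathAlgebra k V) :=
  TwoSidedIdeal.span {x | ∃ (a b : V) (p : Quiver.Path a b), p ∈ R a b ∧
    x = PathAlgebra.ofPath k p}

/-- The path algebra modulo the zero relations `p = 0`, for all paths `p` in `R`. -/
abbrev ZeroRelationAlgebra (k : Type u) [Field k] (V : Type v) [Quiver.{w} V]
    [Fintype V] [DecidableEq V] (R : ∀ a b : V, Set (Quiver.Path a b)) : Type (max u v w) :=
  (zeroRelationIdeal k R).ringCon.Quotient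

/-! ## One-point extensions and coextensions -/

/-- The underlying space of the one-point extension `B[M]` of the `k`-algebra `B` by the right
`B`-module `M`: the triple `(b, m, c)` is the matrix with rows `(b, 0)` and `(m, c)`. -/
def OnePointExtension (k : Type u) (B : Type v) (M : Type w) : Type (max u v w) :=
  B × M × k

namespace OnePointExtension

variable {k : Type u} [Field k] {B : Type v} [Ring B] [Algebra k B]
  {M : Type w} [AddCommGroup M] [Module k M] [Module Bᵐᵒᵖ M] [IsScalarTower k Bᵐᵒᵖ M]

instance : AddCommGroup (OnePointExtension k B M) := inferInstanceAs (AddCommGroup (B × M × k))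

instance : Module k (OnePointExtension k B M) := inferInstanceAs (Module k (B × M × k))

/-- Matrix multiplication: the lower left entry of `(b, m, c) * (b', m', c')` is
`m b' + c m'`. -/
instance : Ring (OnePointExtension k B M) :=
  { (inferInstance : AddCommGroup (OnePointExtension k B M)) with
    mul := fun x y =>
      (x.1 * y.1, MulOpposite.op y.1 • x.2.1 + x.2.2 • y.2.1, x.2.2 * y.2.2)
    one := (1, 0, 1)
    mul_assoc := fun x y z => by
      refine Prod.ext (mul_assoc x.1 y.1 z.1)
        (Prod.ext ?_ (mul_assoc x.2.2 y.2.2 z.2.2))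
      change MulOpposite.op z.1 • (MulOpposite.op y.1 • x.2.1 + x.2.2 • y.2.1)
          + (x.2.2 * y.2.2) • z.2.1
        = MulOpposite.op (y.1 * z.1) • x.2.1
          + x.2.2 • (MulOpposite.op z.1 • y.2.1 + y.2.2 • z.2.1)
      rw [smul_add, smul_add, smul_smul, MulOpposite.op_mul, mul_smul x.2.2,
        smul_comm (MulOpposite.op z.1) x.2.2, add_assoc]
    one_mul := fun x => by
      refine Prod.ext (one_mul x.1) (Prod.ext ?_ (one_mul x.2.2))
      change MulOpposite.op x.1 • (0 : M) + (1 : k) • x.2.1 = x.2.1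
      simp
    mul_one := fun x => by
      refine Prod.ext (mul_one x.1) (Prod.ext ?_ (mul_one x.2.2))
      change MulOpposite.op (1 : B) • x.2.1 + x.2.2 • (0 : M) = x.2.1
      simp
    left_distrib := fun x y z => by
      refine Prod.ext (mul_add x.1 y.1 z.1) (Prod.ext ?_ (mul_add x.2.2 y.2.2 z.2.2))
      change MulOpposite.op (y.1 + z.1) • x.2.1 + x.2.2 • (y.2.1 + z.2.1)
        = (MulOpposite.op y.1 • x.2.1 + x.2.2 • y.2.1)
          + (MulOpposite.op z.1 • x.2.1 + x.2.2 • z.2.1)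
      rw [MulOpposite.op_add, add_smul, smul_add, add_add_add_comm]
    right_distrib := fun x y z => by
      refine Prod.ext (add_mul x.1 y.1 z.1) (Prod.ext ?_ (add_mul x.2.2 y.2.2 z.2.2))
      change MulOpposite.op z.1 • (x.2.1 + y.2.1) + (x.2.2 + y.2.2) • z.2.1
        = (MulOpposite.op z.1 • x.2.1 + x.2.2 • z.2.1)
          + (MulOpposite.op z.1 • y.2.1 + y.2.2 • z.2.1)
      rw [add_smul, smul_add, add_add_add_comm]
    zero_mul := fun x => by
      refine Prod.ext (zero_mul x.1) (Prod.ext ?_ (zero_mul x.2.2))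
      change MulOpposite.op x.1 • (0 : M) + (0 : k) • x.2.1 = 0
      simp
    mul_zero := fun x => by
      refine Prod.ext (mul_zero x.1) (Prod.ext ?_ (mul_zero x.2.2))
      change MulOpposite.op (0 : B) • x.2.1 + x.2.2 • (0 : M) = 0
      simp }

instance : Algebra k (OnePointExtension k B M) :=
  Algebra.ofModule
    (fun r x y => by
      refine Prod.ext (smul_mul_assoc r x.1 y.1)
        (Prod.ext ?_ (smul_mul_assoc r x.2.2 y.2.2))
      change MulOpposite.op y.1 • (r • x.2.1) + (r • x.2.2) • y.2.1
        = r • (MulOpposite.op y.1 • x.2.1 + x.2.2 • y.2.1)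
      rw [smul_add, smul_comm (MulOpposite.op y.1) r, smul_assoc])
    (fun r x y => by
      refine Prod.ext (mul_smul_comm r x.1 y.1)
        (Prod.ext ?_ (mul_smul_comm r x.2.2 y.2.2))
      change MulOpposite.op (r • y.1) • x.2.1 + x.2.2 • (r • y.2.1)
        = r • (MulOpposite.op y.1 • x.2.1 + x.2.2 • y.2.1)
      rw [smul_add, MulOpposite.op_smul, smul_assoc, smul_comm x.2.2 r])

end OnePointExtension

/-- The underlying space of the one-point coextension `[M]B` of the `k`-algebra `B` by the right
`B`-module `M`, with `DM = Hom_k(M, k)` as a left `B`-module: the triple `(c, f, b)` is the matrix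
with rows `(c, 0)` and `(f, b)`. -/
def OnePointCoextension (k : Type u) [Field k] (B : Type v) (M : Type w) [AddCommGroup M]
    [Module k M] : Type (max u v w) :=
  k × Module.Dual k M × B

namespace OnePointCoextension

variable {k : Type u} [Field k] {B : Type v} [Ring B] [Algebra k B]
  {M : Type w} [AddCommGroup M] [Module k M] [Module Bᵐᵒᵖ M] [IsScalarTower k Bᵐᵒᵖ M]

/-- The left action of `B` on `DM`, given by `(b f)(m) = f(m b)`. -/
def dualAct (b : B) (f : Module.Dual k M) : Module.Dual k M :=
  f ∘ₗ Algebra.lsmul k k M (MulOpposite.op b)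

theorem dualAct_apply (b : B) (f : Module.Dual k M) (m : M) :
    dualAct b f m = f (MulOpposite.op b • m) := rfl

instance : AddCommGroup (OnePointCoextension k B M) :=
  inferInstanceAs (AddCommGroup (k × Module.Dual k M × B))

instance : Module k (OnePointCoextension k B M) :=
  inferInstanceAs (Module k (k × Module.Dual k M × B))

/-- Matrix multiplication: the lower left entry of `(c, f, b) * (c', f', b')` is
`f c' + b f'`. -/
instance : Ring (OnePointCoextension k B M) :=
  { (inferInstance : AddCommGroup (OnePointCoextension k B M)) with
    mul := fun x y =>
      (x.1 * y.1, y.1 • x.2.1 + dualAct x.2.2 y.2.1, x.2.2 * y.2.2)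
    one := (1, 0, 1)
    mul_assoc := fun x y z => by
      refine Prod.ext (mul_assoc x.1 y.1 z.1)
        (Prod.ext (LinearMap.ext fun m => ?_) (mul_assoc x.2.2 y.2.2 z.2.2))
      change z.1 * (y.1 * x.2.1 m + y.2.1 (MulOpposite.op x.2.2 • m))
          + z.2.1 (MulOpposite.op (x.2.2 * y.2.2) • m)
        = (y.1 * z.1) * x.2.1 m + (z.1 * y.2.1 (MulOpposite.op x.2.2 • m)
          + z.2.1 (MulOpposite.op y.2.2 • MulOpposite.op x.2.2 • m))
      rw [MulOpposite.op_mul, mul_smul]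
      ring
    one_mul := fun x => by
      refine Prod.ext (one_mul x.1) (Prod.ext (LinearMap.ext fun m => ?_) (one_mul x.2.2))
      change x.1 * 0 + x.2.1 (MulOpposite.op (1 : B) • m) = x.2.1 m
      simp
    mul_one := fun x => by
      refine Prod.ext (mul_one x.1) (Prod.ext (LinearMap.ext fun m => ?_) (mul_one x.2.2))
      change 1 * x.2.1 m + 0 = x.2.1 m
      simp
    left_distrib := fun x y z => by
      refine Prod.ext (mul_add x.1 y.1 z.1)
        (Prod.ext (LinearMap.ext fun m => ?_) (mul_add x.2.2 y.2.2 z.2.2))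
      change (y.1 + z.1) * x.2.1 m
          + (y.2.1 (MulOpposite.op x.2.2 • m) + z.2.1 (MulOpposite.op x.2.2 • m))
        = (y.1 * x.2.1 m + y.2.1 (MulOpposite.op x.2.2 • m))
          + (z.1 * x.2.1 m + z.2.1 (MulOpposite.op x.2.2 • m))
      ring
    right_distrib := fun x y z => by
      refine Prod.ext (add_mul x.1 y.1 z.1)
        (Prod.ext (LinearMap.ext fun m => ?_) (add_mul x.2.2 y.2.2 z.2.2))
      change z.1 * (x.2.1 m + y.2.1 m) + z.2.1 (MulOpposite.op (x.2.2 + y.2.2) • m)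
        = (z.1 * x.2.1 m + z.2.1 (MulOpposite.op x.2.2 • m))
          + (z.1 * y.2.1 m + z.2.1 (MulOpposite.op y.2.2 • m))
      rw [MulOpposite.op_add, add_smul, map_add]
      ring
    zero_mul := fun x => by
      refine Prod.ext (zero_mul x.1) (Prod.ext (LinearMap.ext fun m => ?_) (zero_mul x.2.2))
      change x.1 * 0 + x.2.1 (MulOpposite.op (0 : B) • m) = 0
      simp
    mul_zero := fun x => by
      refine Prod.ext (mul_zero x.1) (Prod.ext (LinearMap.ext fun m => ?_) (mul_zero x.2.2))
      change 0 * x.2.1 m + 0 = 0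
      simp }

instance : Algebra k (OnePointCoextension k B M) :=
  Algebra.ofModule
    (fun r x y => by
      refine Prod.ext (smul_mul_assoc r x.1 y.1)
        (Prod.ext (LinearMap.ext fun m => ?_) (smul_mul_assoc r x.2.2 y.2.2))
      change y.1 * (r * x.2.1 m) + y.2.1 (MulOpposite.op (r • x.2.2) • m)
        = r * (y.1 * x.2.1 m + y.2.1 (MulOpposite.op x.2.2 • m))
      rw [MulOpposite.op_smul, smul_assoc, map_smul, smul_eq_mul]
      ring)
    (fun r x y => by
      refine Prod.ext (mul_smul_comm r x.1 y.1)
        (Prod.ext (LinearMap.ext fun m => ?_) (mul_smul_comm r x.2.2 y.2.2))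
      change (r * y.1) * x.2.1 m + r * y.2.1 (MulOpposite.op x.2.2 • m)
        = r * (y.1 * x.2.1 m + y.2.1 (MulOpposite.op x.2.2 • m))
      ring)

end OnePointCoextension

/-! ## Exceptional modules and accessible algebras -/

/-- A finite-dimensional right `B`-module `M` is exceptional if `End_B(M) = k` (that is, every
endomorphism is a scalar, and distinct scalars act differently) and `Ext^n_B(M, M) = 0` for every
`n > 0`. -/
structure IsExceptional (k : Type u) [Field k] (B : Type v) [Ring B] [Algebra k B]
    (M : Type v) [AddCommGroup M] [Module k M] [Module Bᵐᵒᵖ M] [IsScalarTower k Bᵐᵒᵖ M] :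
    Prop where
  finite : Module.Finite k M
  end_bijective : Function.Bijective (algebraMap k (Module.End Bᵐᵒᵖ M))
  ext_subsingleton : ∀ n : ℕ, 0 < n →
    Subsingleton (Abelian.Ext (ModuleCat.of Bᵐᵒᵖ M) (ModuleCat.of Bᵐᵒᵖ M) n)

/-- A `k`-algebra is accessible if it is isomorphic to the last term of a finite chain of algebras
that starts with `k` and in which each further term is isomorphic to the one-point extension or
the one-point coextension of the preceding one with an exceptional module. -/
inductive IsAccessible (k : Type u) [Field k] : ∀ (A : Type v) [Ring A] [Algebra k A], Prop
  | base (A : Type v) [Ring A] [Algebra k A] (e : A ≃ₐ[k] k) : IsAccessible k A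
  | extension (B : Type v) [Ring B] [Algebra k B] (hB : IsAccessible k B)
      (M : Type v) [AddCommGroup M] [Module k M] [Module Bᵐᵒᵖ M] [IsScalarTower k Bᵐᵒᵖ M]
      (hM : IsExceptional k B M)
      (A : Type v) [Ring A] [Algebra k A] (e : A ≃ₐ[k] OnePointExtension k B M) :
      IsAccessible k A
  | coextension (B : Type v) [Ring B] [Algebra k B] (hB : IsAccessible k B)
      (M : Type v) [AddCommGroup M] [Module k M] [Module Bᵐᵒᵖ M] [IsScalarTower k Bᵐᵒᵖ M]
      (hM : IsExceptional k B M)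
      (A : Type v) [Ring A] [Algebra k A] (e : A ≃ₐ[k] OnePointCoextension k B M) :
      IsAccessible k A

/-! Two vertices of a tree quiver are joined by at most one directed path. The tree algebra
therefore has as basis the paths avoiding the zero relations, and it is an algebra of matrices
indexed by vertices and supported on a relation `G`: the path from a to b exists and avoids the zero
relations (`algEquivTruncAlgebra`). `G` lies in the reachability order and passes to subintervals.
These properties and the tree are all that the induction (`IsTreeShaped.isAccessible`) uses; it
removes a leaf x with neighbour y.

If the arrow is x → y, nothing else reaches x, and the algebra is the one-point extension of the
remaining one by M, the row of x without its diagonal entry. The support U of M is convex and has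
least element y, because every path leaving x runs through y. If the arrow is y → x, the algebra is
a one-point coextension by the module of the column of x, whose support has greatest element y.

Endomorphisms of M are scalar because y is related to all of U. For the Ext groups in the first
case, M is a quotient of the projective P(y), and the kernel is supported on a set E closed under
successors and disjoint from U. Projectives at vertices of E are again supported on E, so the kernel
is resolved by modules with no nonzero map to M, and a dimension shift gives Ext^n(M, M) = 0 for n >
0. In the second case M embeds in the injective I(y), and the cokernel vanishes on the successor
closure of U, where M lives; the same vanishing of Ext between disjoint supports
(`ext_subsingleton_of_idempotent`) applies to the pair M, I(y)/M. -/

/-! ### Vanishing of Ext from idempotents -/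

section ExtVanishing

open Abelian

variable {S : Type v} [Ring S]

/-- The left ideal `S e` as the submodule of `S` of all elements fixed by right
multiplication with `e`. -/
def leftIdealOf (e : S) : Submodule S S := LinearMap.range (LinearMap.toSpanSingleton S S e)

theorem leftIdealOf_mul {e : S} (he : e * e = e) (s : leftIdealOf e) : (s : S) * e = s := by
  obtain ⟨_, t, rfl⟩ := s
  simp [mul_assoc, he]

theorem projective_leftIdealOf {e : S} (he : e * e = e) :
    Module.Projective S (leftIdealOf e) :=
  Module.Projective.of_split (leftIdealOf e).subtype
    (LinearMap.toSpanSingleton S S e).rangeRestrict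
    (LinearMap.ext fun s => Subtype.ext (leftIdealOf_mul he s))

/-- Dimension shifting along a surjection from a projective module. -/
theorem ext_succ_subsingleton_of_ker {P X M : Type v} [AddCommGroup P] [Module S P]
    [AddCommGroup X] [Module S X] [AddCommGroup M] [Module S M] [Module.Projective S P]
    (g : P →ₗ[S] X) (hg : Function.Surjective g) (n : ℕ)
    (hK : Subsingleton (Ext (ModuleCat.of S (LinearMap.ker g)) (ModuleCat.of S M) n)) :
    Subsingleton (Ext (ModuleCat.of S X) (ModuleCat.of S M) (n + 1)) := by
  let T : ShortComplex (ModuleCat.{v} S) := ShortComplex.mk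
    (ModuleCat.ofHom (LinearMap.ker g).subtype) (ModuleCat.ofHom g)
    (ModuleCat.hom_ext (LinearMap.ext fun y => LinearMap.mem_ker.1 y.2))
  have hT : T.ShortExact := by
    refine ModuleCat.shortComplex_shortExact _ ?_ (Submodule.injective_subtype _) hg
    exact LinearMap.exact_subtype_ker_map g
  have : Projective T.X₂ := inferInstanceAs (Projective (ModuleCat.of S P))
  refine subsingleton_of_forall_eq 0 fun x => ?_
  obtain ⟨z, rfl⟩ := Ext.contravariant_sequence_exact₃ hT (ModuleCat.of S M) x
    (Ext.eq_zero_of_projective _) (add_comm 1 n)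
  rw [@Subsingleton.elim _ hK z 0, Ext.comp_zero]

/-- If the idempotent `e` satisfies `(1 - e) S e = 0`, acts as the identity on `X` and as zero on
`M`, then all groups `Ext^n(X, M)` vanish. -/
theorem ext_subsingleton_of_idempotent {e : S} (he : e * e = e) (hS : ∀ s : S, e * (s * e) = s * e)
    (M : Type v) [AddCommGroup M] [Module S M] (hM : ∀ m : M, e • m = 0) (n : ℕ) :
    ∀ (X : Type v) [AddCommGroup X] [Module S X], (∀ x : X, e • x = x) →
      Subsingleton (Ext (ModuleCat.of S X) (ModuleCat.of S M) n) := by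
  induction n with
  | zero =>
    intro X _ _ hX
    refine (Ext.homEquiv₀ (X := ModuleCat.of S X) (Y := ModuleCat.of S M)).subsingleton_congr.2 ?_
    refine subsingleton_of_forall_eq 0 fun f => ModuleCat.hom_ext (LinearMap.ext fun x => ?_)
    have h : f.hom (e • (x : X)) = e • f.hom x := map_smul f.hom e x
    rw [hX x] at h
    exact h.trans (hM _)
  | succ n ih =>
    intro X _ _ hX
    have := projective_leftIdealOf he
    classical
    have : Module.Projective S (X →₀ leftIdealOf e) :=
      Module.Projective.of_equiv (finsuppLequivDFinsupp S (M := leftIdealOf e) (ι := X)).symm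
    -- A sum of copies of S e covers X because e fixes each x. By `hS`, e also acts as the identity
    -- on S e, hence on the kernel, so the induction hypothesis applies to the kernel.
    let g : (X →₀ leftIdealOf e) →ₗ[S] X := Finsupp.lsum ℕ fun x =>
      (LinearMap.toSpanSingleton S X x) ∘ₗ (leftIdealOf e).subtype
    refine ext_succ_subsingleton_of_ker g (fun x => ⟨Finsupp.single x ⟨e, 1, by simp⟩, ?_⟩) n
      (ih _ fun y => Subtype.ext (Finsupp.ext fun x => ?_))
    · exact (Finsupp.lsum_single ..).trans (hX x)
    · obtain ⟨t, ht⟩ := (y.1 x).2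
      refine Subtype.ext (?_ : e * (y.1 x : S) = y.1 x)
      rw [← ht]
      exact hS t

/-- Shifting along g gives Ext^(n+1)(M, M) from Ext^n(ker g, M), where e is the identity on the
kernel and zero on M. Minimality of the cover is not needed. -/
theorem ext_subsingleton_of_projective_cover {e : S} (he : e * e = e)
    (hS : ∀ s : S, e * (s * e) = s * e) {P M : Type v} [AddCommGroup M] [Module S M]
    [AddCommGroup P] [Module S P] [Module.Projective S P]
    (hM : ∀ m : M, e • m = 0) (g : P →ₗ[S] M) (hg : Function.Surjective g)
    (hK : ∀ x, g x = 0 → e • x = x) (n : ℕ) (hn : 0 < n) :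
    Subsingleton (Ext (ModuleCat.of S M) (ModuleCat.of S M) n) := by
  obtain ⟨n, rfl⟩ : ∃ m, n = m + 1 := ⟨n - 1, by omega⟩
  exact ext_succ_subsingleton_of_ker g hg n (ext_subsingleton_of_idempotent he hS M hM n _
    fun y => Subtype.ext (hK y y.2))

/-- Shifting along f in the second variable leads to Ext^n(M, I / M). Now M is the module fixed by
e, and `hC` says that e kills the cokernel; the condition on e is the same as in the projective
case, not its dual. -/
theorem ext_subsingleton_of_injective_hull {e : S} (he : e * e = e)
    (hS : ∀ s : S, e * (s * e) = s * e) {I M : Type v} [AddCommGroup M] [Module S M]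
    [AddCommGroup I] [Module S I] (hI : Module.Injective S I)
    (hM : ∀ m : M, e • m = m) (f : M →ₗ[S] I) (hf : Function.Injective f)
    (hC : ∀ x, e • x ∈ LinearMap.range f) (n : ℕ) (hn : 0 < n) :
    Subsingleton (Ext (ModuleCat.of S M) (ModuleCat.of S M) n) := by
  obtain ⟨n, rfl⟩ : ∃ m, n = m + 1 := ⟨n - 1, by omega⟩
  have hC := ext_subsingleton_of_idempotent he hS (I ⧸ LinearMap.range f) (fun y => by
    obtain ⟨x, rfl⟩ := Submodule.mkQ_surjective _ y
    rw [← map_smul]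
    exact (Submodule.Quotient.mk_eq_zero _).2 (hC x)) n M hM
  let T : ShortComplex (ModuleCat.{v} S) := ShortComplex.mk
    (ModuleCat.ofHom f) (ModuleCat.ofHom (LinearMap.range f).mkQ)
    (ModuleCat.hom_ext (LinearMap.range_mkQ_comp f))
  have hT : T.ShortExact := by
    refine ModuleCat.shortComplex_shortExact _ ?_ hf (Submodule.mkQ_surjective _)
    exact LinearMap.exact_map_mkQ_range f
  have : Injective T.X₂ := Module.injective_object_of_injective_module (R := S) (M := I)
  refine subsingleton_of_forall_eq 0 fun x => ?_
  obtain ⟨z, rfl⟩ := Ext.covariant_sequence_exact₁ (ModuleCat.of S M) hT x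
    (Ext.eq_zero_of_injective _) rfl
  rw [@Subsingleton.elim _ hC z 0, Ext.zero_comp]

end ExtVanishing

section IncidenceAlgebra

/-! ## Truncated incidence algebras -/

section TruncAct

variable {k : Type u} [Field k] {V : Type v} [Fintype V]

open scoped Classical in
/-- The product of a row vector with a matrix, truncated to `U`. -/
noncomputable def truncAct (U : Set V) (m : V → k) (g : V → V → k) (z : V) : k :=
  if z ∈ U then ∑ w, m w * g w z else 0

theorem truncAct_of_mem {U : Set V} {z : V} (hz : z ∈ U) (m : V → k) (g : V → V → k) :
    truncAct U m g z = ∑ w, m w * g w z := if_pos hz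

theorem truncAct_of_notMem {U : Set V} {z : V} (hz : z ∉ U) (m : V → k) (g : V → V → k) :
    truncAct U m g z = 0 := if_neg hz

theorem truncAct_add_left (U : Set V) (m n : V → k) (g : V → V → k) (z : V) :
    truncAct U (fun a => m a + n a) g z = truncAct U m g z + truncAct U n g z := by
  simp only [truncAct]
  split_ifs <;> simp [add_mul, Finset.sum_add_distrib]

theorem truncAct_add_right (U : Set V) (m : V → k) (f g : V → V → k) (z : V) :
    truncAct U m (fun a b => f a b + g a b) z = truncAct U m f z + truncAct U m g z := by
  simp only [truncAct]
  split_ifs <;> simp [mul_add, Finset.sum_add_distrib]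

theorem truncAct_smul_left (U : Set V) (c : k) (m : V → k) (g : V → V → k) (z : V) :
    truncAct U (fun a => c * m a) g z = c * truncAct U m g z := by
  simp only [truncAct]
  split_ifs <;> simp [Finset.mul_sum, mul_assoc]

theorem truncAct_smul_right (U : Set V) (c : k) (m : V → k) (g : V → V → k) (z : V) :
    truncAct U m (fun a b => c * g a b) z = c * truncAct U m g z := by
  simp only [truncAct]
  split_ifs <;> simp [Finset.mul_sum, mul_left_comm]

theorem truncAct_zero_left (U : Set V) (g : V → V → k) (z : V) :
    truncAct U (fun _ => 0) g z = 0 := by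
  simp [truncAct]

theorem truncAct_zero_right (U : Set V) (m : V → k) (z : V) :
    truncAct U m (fun _ _ => 0) z = 0 := by
  simp [truncAct]

end TruncAct

/-- A reflexive relation contained in the order that passes to subintervals. -/
structure ConvexRel (V : Type v) [PartialOrder V] where
  /-- The underlying relation. -/
  rel : V → V → Prop
  refl : ∀ a, rel a a
  le : ∀ {a b}, rel a b → a ≤ b
  left : ∀ {a b c}, rel a c → a ≤ b → b ≤ c → rel a b
  right : ∀ {a b c}, rel a c → a ≤ b → b ≤ c → rel b c

namespace ConvexRel

variable {V : Type v} [PartialOrder V]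

/-- A convex set of vertices on which the relation agrees with the order. -/
structure Block (G : ConvexRel V) where
  /-- The underlying set. -/
  carrier : Set V
  convex : ∀ {a b c}, a ∈ carrier → c ∈ carrier → a ≤ b → b ≤ c → b ∈ carrier
  rel : ∀ {a b}, a ∈ carrier → b ∈ carrier → a ≤ b → G.rel a b

variable (G : ConvexRel V)

/-- The block of all vertices `z` with `G.rel x z`. -/
def row (x : V) : G.Block where
  carrier := {z | G.rel x z}
  convex := fun ha hc hab hbc => G.left hc ((G.le ha).trans hab) hbc
  rel := fun ha hb hab => G.right hb (G.le ha) hab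

/-- The block of all vertices `z` with `G.rel z x`. -/
def col (x : V) : G.Block where
  carrier := {z | G.rel z x}
  convex := fun ha hc hab hbc => G.right ha hab (hbc.trans (G.le hc))
  rel := fun ha hb hab => G.left ha hab (G.le hb)

@[simp] theorem mem_row {x z : V} : z ∈ (G.row x).carrier ↔ G.rel x z := Iff.rfl

/-- The restriction of the relation to a subtype. -/
def restrict (p : V → Prop) : ConvexRel {v // p v} where
  rel := fun a b => G.rel a b
  refl := fun a => G.refl a
  le := fun h => G.le h
  left := fun h h₁ h₂ => G.left h h₁ h₂
  right := fun h h₁ h₂ => G.right h h₁ h₂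

/-- The restriction of a block to a subtype. -/
def Block.restrict {G : ConvexRel V} (U : G.Block) (p : V → Prop) : (G.restrict p).Block where
  carrier := {v | v.1 ∈ U.carrier}
  convex := fun ha hc h₁ h₂ => U.convex ha hc h₁ h₂
  rel := fun ha hb h => U.rel ha hb h

end ConvexRel

/-- The matrices supported on the relation `G`. -/
def TruncAlgebra (k : Type u) [Field k] {V : Type v} [PartialOrder V] (G : ConvexRel V) :
    Type (max u v) :=
  ({ carrier := {f | ∀ a b, ¬ G.rel a b → f a b = 0}
     add_mem' := fun hf hg a b h => by simp [hf a b h, hg a b h]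
     zero_mem' := fun _ _ _ => rfl
     smul_mem' := fun c f hf a b h => by simp [hf a b h] } : Submodule k (V → V → k))

/-- The functions supported on the block `U`. -/
def BlockModule (k : Type u) [Field k] {V : Type v} [PartialOrder V] {G : ConvexRel V}
    (U : G.Block) : Type (max u v) :=
  ({ carrier := {f | ∀ a, a ∉ U.carrier → f a = 0}
     add_mem' := fun hf hg a h => by simp [hf a h, hg a h]
     zero_mem' := fun _ _ => rfl
     smul_mem' := fun c f hf a h => by simp [hf a h] } : Submodule k (V → k))

variable {k : Type u} [Field k] {V : Type v} [PartialOrder V] {G : ConvexRel V}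

noncomputable instance : AddCommGroup (TruncAlgebra k G) :=
  inferInstanceAs (AddCommGroup (Submodule.mk _ _ : Submodule k (V → V → k)))

noncomputable instance : Module k (TruncAlgebra k G) :=
  inferInstanceAs (Module k (Submodule.mk _ _ : Submodule k (V → V → k)))

noncomputable instance (U : G.Block) : AddCommGroup (BlockModule k U) :=
  inferInstanceAs (AddCommGroup (Submodule.mk _ _ : Submodule k (V → k)))

noncomputable instance (U : G.Block) : Module k (BlockModule k U) :=
  inferInstanceAs (Module k (Submodule.mk _ _ : Submodule k (V → k)))

instance [Finite V] (U : G.Block) : Module.Finite k (BlockModule k U) :=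
  inferInstanceAs (Module.Finite k (Submodule.mk _ _ : Submodule k (V → k)))

namespace TruncAlgebra

theorem eq_zero (f : TruncAlgebra k G) {a b : V} (h : ¬ G.rel a b) : f.1 a b = 0 := f.2 a b h

theorem ext_rel {f g : TruncAlgebra k G} (h : ∀ a b, G.rel a b → f.1 a b = g.1 a b) : f = g :=
  Subtype.ext (funext fun a => funext fun b => by
    by_cases hab : G.rel a b
    · exact h a b hab
    · rw [f.eq_zero hab, g.eq_zero hab])

@[simp] theorem add_val (f g : TruncAlgebra k G) (a b : V) :
    (f + g).1 a b = f.1 a b + g.1 a b := rfl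

@[simp] theorem zero_val (a b : V) : (0 : TruncAlgebra k G).1 a b = 0 := rfl

@[simp] theorem smul_val (c : k) (f : TruncAlgebra k G) (a b : V) :
    (c • f).1 a b = c * f.1 a b := rfl

end TruncAlgebra

namespace BlockModule

variable {U : G.Block}

theorem eq_zero (m : BlockModule k U) {a : V} (h : a ∉ U.carrier) : m.1 a = 0 := m.2 a h

theorem ext_mem {m n : BlockModule k U} (h : ∀ a, a ∈ U.carrier → m.1 a = n.1 a) : m = n :=
  Subtype.ext (funext fun a => by
    by_cases ha : a ∈ U.carrier
    · exact h a ha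
    · rw [m.eq_zero ha, n.eq_zero ha])

@[simp] theorem add_val (m n : BlockModule k U) (a : V) : (m + n).1 a = m.1 a + n.1 a := rfl

@[simp] theorem zero_val (a : V) : (0 : BlockModule k U).1 a = 0 := rfl

@[simp] theorem smul_val (c : k) (m : BlockModule k U) (a : V) : (c • m).1 a = c * m.1 a := rfl

end BlockModule

variable [Fintype V]

/-- Associativity, both for the algebra (U a row) and for its action on block modules. Both sides
are the full double sum: a middle vertex outside U is excluded by convexity, and truncation at an
unrelated pair w, z of U loses nothing because w ≤ z inside U would force `G.rel w z`. -/
theorem truncAct_truncAct (U : G.Block) {m : V → k} (hm : ∀ a, a ∉ U.carrier → m a = 0)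
    (f g : TruncAlgebra k G) (z : V) :
    truncAct U.carrier (truncAct U.carrier m f.1) g.1 z =
      truncAct U.carrier m (fun a => truncAct (G.row a).carrier (f.1 a) g.1) z := by
  by_cases hz : z ∈ U.carrier
  · rw [truncAct_of_mem hz, truncAct_of_mem hz]
    have h₁ : ∀ v, truncAct U.carrier m f.1 v * g.1 v z = ∑ w, m w * f.1 w v * g.1 v z := by
      intro v
      rw [← Finset.sum_mul]
      by_cases hv : v ∈ U.carrier
      · rw [truncAct_of_mem hv]
      · rw [truncAct_of_notMem hv, zero_mul, Finset.sum_mul]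
        refine (Finset.sum_eq_zero fun w _ => ?_).symm
        by_cases hw : w ∈ U.carrier
        · by_cases hwv : G.rel w v
          · by_cases hvz : G.rel v z
            · exact absurd (U.convex hw hz (G.le hwv) (G.le hvz)) hv
            · rw [g.eq_zero hvz, mul_zero]
          · rw [f.eq_zero hwv, mul_zero, zero_mul]
        · rw [hm w hw, zero_mul, zero_mul]
    have h₂ : ∀ w, m w * truncAct (G.row w).carrier (f.1 w) g.1 z =
        ∑ v, m w * f.1 w v * g.1 v z := by
      intro w
      by_cases hwz : G.rel w z
      · rw [truncAct_of_mem (by exact hwz), Finset.mul_sum]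
        simp only [mul_assoc]
      · rw [truncAct_of_notMem (by exact hwz), mul_zero]
        refine (Finset.sum_eq_zero fun v _ => ?_).symm
        by_cases hw : w ∈ U.carrier
        · by_cases hwv : G.rel w v
          · by_cases hvz : G.rel v z
            · exact absurd (U.rel hw hz ((G.le hwv).trans (G.le hvz))) hwz
            · rw [g.eq_zero hvz, mul_zero]
          · rw [f.eq_zero hwv, mul_zero, zero_mul]
        · rw [hm w hw, zero_mul, zero_mul]
    simp only [h₁, h₂]
    exact Finset.sum_comm
  · rw [truncAct_of_notMem hz, truncAct_of_notMem hz]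

namespace TruncAlgebra

open scoped Classical in
/-- The diagonal idempotent of a set of vertices. -/
noncomputable def diag (k : Type u) [Field k] (G : ConvexRel V) (E : Set V) :
    TruncAlgebra k G :=
  ⟨fun a b => if a = b ∧ b ∈ E then 1 else 0, fun a b h => if_neg fun h' => h (by
    rw [h'.1]
    exact G.refl b)⟩

open scoped Classical in
/-- The matrix unit at `(a, b)`; zero if `a` and `b` are unrelated. -/
noncomputable def unit (k : Type u) [Field k] (G : ConvexRel V) (a b : V) :
    TruncAlgebra k G :=
  ⟨fun i j => if i = a ∧ j = b ∧ G.rel i j then 1 else 0,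
    fun _ _ h => if_neg fun h' => h h'.2.2⟩

open scoped Classical in
omit [Fintype V] in
theorem unit_val (a b i j : V) :
    (unit k G a b).1 i j = if i = a ∧ j = b ∧ G.rel i j then 1 else 0 := rfl

open scoped Classical in
theorem truncAct_diag (U : Set V) (m : V → k) (E : Set V) (z : V) :
    truncAct U m (diag k G E).1 z = if z ∈ U ∧ z ∈ E then m z else 0 := by
  simp only [truncAct, diag]
  by_cases hz : z ∈ U <;> by_cases hE : z ∈ E <;> simp [hz, hE]

open scoped Classical in
theorem truncAct_unit (U : Set V) (m : V → k) (a b z : V) :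
    truncAct U m (unit k G a b).1 z = if z ∈ U ∧ z = b ∧ G.rel a b then m a else 0 := by
  simp only [truncAct, unit]
  by_cases hz : z ∈ U
  · rw [if_pos hz, Finset.sum_eq_single a]
    · by_cases hb : z = b
      · subst hb
        simp [hz]
      · simp [hb]
    · intro c _ hc
      simp [hc]
    · simp
  · simp [hz]

noncomputable instance : Ring (TruncAlgebra k G) :=
  { (inferInstance : AddCommGroup (TruncAlgebra k G)) with
    mul := fun f g => ⟨fun a => truncAct (G.row a).carrier (f.1 a) g.1,
      fun _ _ h => truncAct_of_notMem h _ _⟩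
    one := diag k G Set.univ
    mul_assoc := fun f g h => ext_rel fun a z _ =>
      truncAct_truncAct (G.row a) (fun b hb => f.2 a b hb) g h z
    one_mul := fun f => ext_rel fun a z haz => by
      change truncAct (G.row a).carrier ((diag k G Set.univ).1 a) f.1 z = f.1 a z
      rw [truncAct_of_mem (by exact haz), Finset.sum_eq_single a]
      · simp [diag]
      · intro c _ hc
        simp [diag, hc.symm]
      · simp
    mul_one := fun f => ext_rel fun a z haz => by
      change truncAct (G.row a).carrier (f.1 a) (diag k G Set.univ).1 z = f.1 a z
      rw [truncAct_diag]
      simp [haz]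
    left_distrib := fun f g h => ext_rel fun a z _ => truncAct_add_right _ _ _ _ _
    right_distrib := fun f g h => ext_rel fun a z _ => truncAct_add_left _ _ _ _ _
    zero_mul := fun f => ext_rel fun a z _ => truncAct_zero_left _ _ _
    mul_zero := fun f => ext_rel fun a z _ => truncAct_zero_right _ _ _ }

theorem mul_val (f g : TruncAlgebra k G) (a : V) :
    (f * g).1 a = truncAct (G.row a).carrier (f.1 a) g.1 := rfl

theorem mul_val_of_rel (f g : TruncAlgebra k G) {a b : V} (h : G.rel a b) :
    (f * g).1 a b = ∑ c, f.1 a c * g.1 c b := truncAct_of_mem h _ _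

noncomputable instance : Algebra k (TruncAlgebra k G) :=
  Algebra.ofModule
    (fun _ _ _ => ext_rel fun _ _ _ => truncAct_smul_left _ _ _ _ _)
    (fun _ _ _ => ext_rel fun _ _ _ => truncAct_smul_right _ _ _ _ _)

theorem diag_mul_diag (E : Set V) : diag k G E * diag k G E = diag k G E :=
  ext_rel fun a b h => by
    classical
    rw [mul_val, truncAct_diag]
    by_cases hb : b ∈ E <;> simp [diag, hb, h]

open scoped Classical in
theorem diag_mul_val (E : Set V) (f : TruncAlgebra k G) (a b : V) :
    (diag k G E * f).1 a b = if a ∈ E then f.1 a b else 0 := by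
  by_cases hab : G.rel a b
  · rw [mul_val_of_rel _ _ hab]
    by_cases ha : a ∈ E
    · rw [Finset.sum_eq_single a]
      · simp [diag, ha]
      · intro c _ hc
        simp [diag, hc.symm]
      · simp
    · rw [if_neg ha]
      refine Finset.sum_eq_zero fun c _ => ?_
      have : ¬ (a = c ∧ c ∈ E) := fun h => ha (h.1 ▸ h.2)
      simp [diag, this]
  · rw [eq_zero _ hab, eq_zero _ hab, ite_self]

/-- Rows indexed by E only have entries in columns of E. In the opposite ring this is the condition
`hS` of the Ext lemmas. -/
theorem diag_mul_mul_diag {E : Set V} (hE : ∀ {a b}, a ∈ E → G.rel a b → b ∈ E)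
    (f : TruncAlgebra k G) : diag k G E * f * diag k G E = diag k G E * f :=
  ext_rel fun a b h => by
    classical
    rw [mul_val, truncAct_diag, diag_mul_val]
    by_cases ha : a ∈ E
    · simp [h, hE ha h]
    · simp [ha]

end TruncAlgebra

namespace BlockModule

open MulOpposite TruncAlgebra

variable {U : G.Block}

noncomputable instance : Module (TruncAlgebra k G)ᵐᵒᵖ (BlockModule k U) where
  smul f m := ⟨truncAct U.carrier m.1 f.unop.1, fun _ h => truncAct_of_notMem h _ _⟩
  one_smul m := ext_mem fun a ha => by
    change truncAct U.carrier m.1 (diag k G Set.univ).1 a = m.1 a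
    rw [truncAct_diag]
    simp [ha]
  mul_smul f g m := Subtype.ext (funext fun z => (truncAct_truncAct U m.2 g.unop f.unop z).symm)
  smul_zero f := ext_mem fun a ha => truncAct_zero_left _ _ _
  smul_add f m n := ext_mem fun a ha => truncAct_add_left _ _ _ _ _
  add_smul f g m := ext_mem fun a ha => truncAct_add_right _ _ _ _ _
  zero_smul m := ext_mem fun a ha => truncAct_zero_right _ _ _

theorem op_smul_val (f : TruncAlgebra k G) (m : BlockModule k U) (z : V) :
    (op f • m).1 z = truncAct U.carrier m.1 f.1 z := rfl

instance : IsScalarTower k (TruncAlgebra k G)ᵐᵒᵖ (BlockModule k U) where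
  smul_assoc _ _ _ := ext_mem fun _ _ => truncAct_smul_right _ _ _ _ _

end BlockModule

end IncidenceAlgebra

/-! ### Block modules: endomorphisms, projectives, injectives, exceptionality -/

section BlockModules

variable {k : Type u} [Field k] {V : Type v} [PartialOrder V] {G : ConvexRel V} [Fintype V]

namespace BlockModule

open MulOpposite TruncAlgebra

open scoped Classical in
/-- The basis vector at `z`; zero if `z` is not in the block. -/
noncomputable def single (k : Type u) [Field k] (U : G.Block) (z : V) : BlockModule k U :=
  ⟨fun w => if w = z ∧ w ∈ U.carrier then 1 else 0, fun _ h => if_neg fun h' => h h'.2⟩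

omit [Fintype V] in
theorem single_self {U : G.Block} {z : V} (hz : z ∈ U.carrier) : (single k U z).1 z = 1 :=
  if_pos ⟨rfl, hz⟩

theorem unit_smul {U : G.Block} {a b : V} (h : G.rel a b) (m : BlockModule k U) :
    op (unit k G a b) • m = m.1 a • single k U b := ext_mem fun z hz => by
  classical
  rw [op_smul_val, truncAct_unit, smul_val]
  by_cases hzb : z = b <;> simp [single, hz, hzb, h]

theorem unit_smul_val {U : G.Block} {a b : V} (h : G.rel a b) (hb : b ∈ U.carrier)
    (m : BlockModule k U) : (op (unit k G a b) • m).1 b = m.1 a := by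
  rw [unit_smul h, smul_val, single_self hb, mul_one]

theorem diag_smul_eq_zero {U : G.Block} {E : Set V} (h : ∀ z ∈ U.carrier, z ∉ E)
    (m : BlockModule k U) : op (diag k G E) • m = 0 := ext_mem fun z hz => by
  classical
  rw [op_smul_val, truncAct_diag, if_neg fun h' => h z hz h'.2, zero_val]

theorem diag_smul_eq_self {U : G.Block} {E : Set V} (m : BlockModule k U)
    (h : ∀ z, m.1 z ≠ 0 → z ∈ E) : op (diag k G E) • m = m := ext_mem fun z hz => by
  classical
  rw [op_smul_val, truncAct_diag]
  by_cases hz' : m.1 z = 0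
  · rw [hz', ite_self]
  · rw [if_pos ⟨hz, h z hz'⟩]

/-- Commuting with the matrix units makes an endomorphism diagonal, with equal scalars at related
vertices; since y is related to every vertex of U, only one scalar remains. -/
theorem algebraMap_end_bijective {U : G.Block} {y : V} (hy : y ∈ U.carrier)
    (h : ∀ z ∈ U.carrier, G.rel y z ∨ G.rel z y) :
    Function.Bijective (algebraMap k (Module.End (TruncAlgebra k G)ᵐᵒᵖ (BlockModule k U))) := by
  constructor
  · intro c d hcd
    have := congrArg (fun f => (f (single k U y)).1 y) hcd
    simpa [Module.algebraMap_end_apply, single_self hy] using this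
  · intro f
    -- Compare the coordinates at b after applying f to m times the matrix unit (a, b).
    have key : ∀ {a b : V}, G.rel a b → a ∈ U.carrier → b ∈ U.carrier → ∀ m : BlockModule k U,
        (f m).1 a = m.1 a * (f (single k U b)).1 b := fun {a b} hab _ hb m => by
      rw [← unit_smul_val hab hb (f m), ← map_smul, unit_smul hab, LinearMap.map_smul_of_tower,
        smul_val]
    have key' : ∀ {a b : V}, G.rel a b → a ∈ U.carrier → b ∈ U.carrier →
        (f (single k U a)).1 a = (f (single k U b)).1 b := fun hab ha hb => by
      rw [key hab ha hb, single_self ha, one_mul]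
    refine ⟨(f (single k U y)).1 y, LinearMap.ext fun m => ext_mem fun z hz => ?_⟩
    rw [Module.algebraMap_end_apply, smul_val, key (G.refl z) hz hz m, mul_comm]
    rcases h z hz with h' | h'
    · rw [key' h' hy hz]
    · rw [key' h' hz hy]

open scoped Classical in
/-- The matrix whose only nonzero row is the row `y`, given by an element of the module of the
block `G.row y`. -/
noncomputable def toMatrixRow (y : V) (m : BlockModule k (G.row y)) : TruncAlgebra k G :=
  ⟨fun a b => if a = y then m.1 b else 0, fun a b h => by
    change (if a = y then m.1 b else 0) = 0
    split_ifs with ha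
    · exact m.eq_zero fun h' => h (ha ▸ h')
    · rfl⟩

open scoped Classical in
omit [Fintype V] in
theorem toMatrixRow_val (y : V) (m : BlockModule k (G.row y)) (a b : V) :
    (toMatrixRow y m).1 a b = if a = y then m.1 b else 0 := rfl

/-- This is the right ideal generated by the diagonal idempotent at y. Acting on the basis vector at
y extracts row y of a matrix and splits the inclusion. -/
instance projective_row (y : V) :
    Module.Projective (TruncAlgebra k G)ᵐᵒᵖ (BlockModule k (G.row y)) := by
  refine Module.Projective.of_split (P := BlockModule k (G.row y)) (M := (TruncAlgebra k G)ᵐᵒᵖ)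
    { toFun := fun m => op (toMatrixRow y m)
      map_add' := fun m n => congrArg op (ext_rel fun a b _ => ?_)
      map_smul' := fun f m => congrArg op (ext_rel fun a b hab => ?_) }
    (LinearMap.toSpanSingleton _ _ (single k (G.row y) y))
    (LinearMap.ext fun m => ext_mem fun z hz => ?_)
  · change (toMatrixRow y (m + n)).1 a b = (toMatrixRow y m).1 a b + (toMatrixRow y n).1 a b
    by_cases ha : a = y <;> simp [toMatrixRow_val, ha]
  · change _ = (toMatrixRow y m * f.unop).1 a b
    rw [mul_val]
    by_cases ha : a = y
    · subst ha
      simp only [toMatrixRow, if_true]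
      rfl
    · simp only [toMatrixRow, ha, if_false]
      rw [truncAct_zero_left]
  · change truncAct _ (single k (G.row y) y).1 (toMatrixRow y m).1 z = m.1 z
    rw [truncAct_of_mem hz, Finset.sum_eq_single y]
    · simp [toMatrixRow, single, G.refl]
    · intro c _ hc
      simp [toMatrixRow, hc]
    · simp

/-- This module is the k-dual of the left projective at y, so a homomorphism g into it is determined
by the linear form taking the y-coordinate of g. Baer's criterion reduces to extending that form
k-linearly. -/
theorem injective_col (y : V) :
    Module.Injective (TruncAlgebra k G)ᵐᵒᵖ (BlockModule k (G.col y)) := by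
  refine Module.Baer.injective fun I g => ?_
  let φ : (I.restrictScalars k) →ₗ[k] k :=
    { toFun := fun s => (g s).1 y
      map_add' := fun s t => by
        rw [show g (s + t) = g s + g t from map_add g _ _, add_val]
      map_smul' := fun c s => by
        rw [show g (c • s) = c • g s from g.map_smul_of_tower c _, smul_val]
        rfl }
  obtain ⟨ψ, hψ⟩ := LinearMap.exists_extend φ
  have hψ' : ∀ s (hs : s ∈ I), ψ s = (g ⟨s, hs⟩).1 y := fun s hs =>
    LinearMap.congr_fun hψ ⟨s, hs⟩
  classical
  -- The image of 1 under the extension of g: its z-coordinate is the y-coordinate after acting with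
  -- the matrix unit (z, y), hence the value of ψ there.
  let m₀ : BlockModule k (G.col y) := ⟨fun z => if G.rel z y then ψ (op (unit k G z y)) else 0,
    fun _ h => if_neg h⟩
  refine ⟨LinearMap.toSpanSingleton _ _ m₀, fun s hs => ext_mem fun z hz => ?_⟩
  have hz' : G.rel z y := hz
  have h₁ : (g ⟨s, hs⟩).1 z = ψ (op (s.unop * unit k G z y)) := by
    have hy : y ∈ (G.col y).carrier := G.refl y
    rw [← unit_smul_val hz' hy, ← map_smul, ← hψ']
    rfl
  have h₂ : s.unop * unit k G z y = ∑ w, s.unop.1 w z • unit k G w y := by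
    refine ext_rel fun a b hab => ?_
    have h₃ : ∀ F : V → TruncAlgebra k G, (∑ w, F w).1 a b = ∑ w, (F w).1 a b := fun F =>
      map_sum (AddMonoidHom.mk' (fun f : TruncAlgebra k G => f.1 a b) fun _ _ => rfl) F _
    rw [mul_val, truncAct_unit, h₃, Finset.sum_eq_single a]
    · by_cases hb : b = y
      · subst hb
        have hab' : b ∈ (G.row a).carrier := hab
        simp [unit_val, hab, hz']
      · simp [unit_val, hb]
    · intro c _ hc
      simp [unit_val, hc.symm]
    · simp
  change truncAct _ m₀.1 s.unop.1 z = _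
  rw [truncAct_of_mem hz, h₁, h₂, Finset.op_sum, map_sum]
  refine Finset.sum_congr rfl fun w _ => ?_
  rw [op_smul, map_smul, smul_eq_mul, mul_comm]
  by_cases hw : G.rel w y
  · simp only [m₀, if_pos hw]
  · have : unit k G w y = 0 := ext_rel fun a b hab => by
      rw [unit_val]
      exact if_neg (by rintro ⟨rfl, rfl, h⟩; exact hw h)
    simp only [m₀, if_neg hw, this, op_zero, map_zero]

variable {U : G.Block} {y : V}

theorem isExceptional_of_isLeast (hy : IsLeast U.carrier y) :
    IsExceptional k (TruncAlgebra k G) (BlockModule k U) where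
  finite := inferInstance
  end_bijective := algebraMap_end_bijective hy.1 fun z hz => Or.inl (U.rel hy.1 hz (hy.2 hz))
  ext_subsingleton := by
    classical
    -- The kernel of the restriction from `G.row y` to U is supported here. Convexity and y ∈ U make
    -- E closed under successors.
    let E : Set V := {z | y ≤ z ∧ z ∉ U.carrier}
    let g : BlockModule k (G.row y) →ₗ[(TruncAlgebra k G)ᵐᵒᵖ] BlockModule k U :=
      { toFun := fun m => ⟨fun z => if z ∈ U.carrier then m.1 z else 0, fun _ h => if_neg h⟩
        map_add' := fun m n => ext_mem fun z hz => by
          change (if z ∈ U.carrier then (m + n).1 z else 0) =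
            (if z ∈ U.carrier then m.1 z else 0) + (if z ∈ U.carrier then n.1 z else 0)
          simp [hz]
        -- A coordinate w outside U cannot feed into z ∈ U: y ≤ w ≤ z would put w in U.
        map_smul' := fun f m => ext_mem fun z hz => by
          have hyz : z ∈ (G.row y).carrier := U.rel hy.1 hz (hy.2 hz)
          change (if z ∈ U.carrier then truncAct _ m.1 f.unop.1 z else 0) =
            truncAct _ _ f.unop.1 z
          rw [if_pos hz, truncAct_of_mem hz, truncAct_of_mem hyz]
          refine Finset.sum_congr rfl fun w _ => ?_
          by_cases hw : w ∈ U.carrier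
          · simp only [if_pos hw]
          · simp only [if_neg hw, zero_mul]
            by_cases hwz : G.rel w z
            · rw [m.eq_zero, zero_mul]
              exact fun hyw => hw (U.convex hy.1 hz (G.le hyw) (G.le hwz))
            · rw [f.unop.eq_zero hwz, mul_zero] }
    refine ext_subsingleton_of_projective_cover (e := op (diag k G E))
      (by rw [← op_mul, diag_mul_diag]) (fun s => ?_)
      (diag_smul_eq_zero fun z hz h => h.2 hz) g (fun m => ?_) fun m hm => ?_
    · refine congrArg op (diag_mul_mul_diag (E := E) (fun {a b} ha hab => ⟨ha.1.trans (G.le hab),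
        fun hb => ha.2 (U.convex hy.1 hb ha.1 (G.le hab))⟩) s.unop)
    · refine ⟨(⟨m.1, fun a ha => m.eq_zero fun h => ha (U.rel hy.1 h (hy.2 h))⟩ :
        BlockModule k (G.row y)),
        ext_mem fun z hz => if_pos hz⟩
    · refine diag_smul_eq_self m fun z hz => ⟨G.le (?_ : z ∈ (G.row y).carrier), fun hz' => hz ?_⟩
      · by_contra h
        exact hz (m.eq_zero h)
      · have : (g m).1 z = 0 := by rw [hm, zero_val]
        exact (if_pos hz').symm.trans this

theorem isExceptional_of_isGreatest (hy : IsGreatest U.carrier y) :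
    IsExceptional k (TruncAlgebra k G) (BlockModule k U) where
  finite := inferInstance
  end_bijective := algebraMap_end_bijective hy.1 fun z hz => Or.inr (U.rel hz hy.1 (hy.2 hz))
  ext_subsingleton := by
    classical
    -- E contains U and, by convexity, meets `G.col y` only in U, so the idempotent of E fixes M and
    -- kills the cokernel.
    let E : Set V := {z | ∃ a ∈ U.carrier, a ≤ z}
    have hcol : ∀ {z}, z ∈ U.carrier → z ∈ (G.col y).carrier := fun hz => U.rel hz hy.1 (hy.2 hz)
    let f : BlockModule k U →ₗ[(TruncAlgebra k G)ᵐᵒᵖ] BlockModule k (G.col y) :=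
      { toFun := fun m => ⟨m.1, fun a ha => m.eq_zero fun h => ha (hcol h)⟩
        map_add' := fun m n => rfl
        map_smul' := fun f m => ext_mem fun z hz => by
          change truncAct _ m.1 f.unop.1 z = truncAct _ m.1 f.unop.1 z
          rw [truncAct_of_mem hz]
          by_cases hzU : z ∈ U.carrier
          · rw [truncAct_of_mem hzU]
          · rw [truncAct_of_notMem hzU]
            refine (Finset.sum_eq_zero fun w _ => ?_).symm
            by_cases hw : w ∈ U.carrier
            · rw [f.unop.eq_zero, mul_zero]
              exact fun hwz => hzU (U.convex hw hy.1 (G.le hwz) (G.le hz))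
            · rw [m.eq_zero hw, zero_mul] }
    refine ext_subsingleton_of_injective_hull (e := op (diag k G E))
      (by rw [← op_mul, diag_mul_diag]) (fun s => ?_) (injective_col y)
      (fun m => diag_smul_eq_self m fun z hz => ⟨z, ?_, le_rfl⟩) f (fun m n h => ?_) fun m => ?_
    · exact congrArg op (diag_mul_mul_diag (fun {a b} ha hab => by
        obtain ⟨c, hc, hca⟩ := ha
        exact ⟨c, hc, hca.trans (G.le hab)⟩) s.unop)
    · by_contra h
      exact hz (m.eq_zero h)
    · exact Subtype.ext (congrArg (fun x : BlockModule k (G.col y) => x.1) h)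
    · refine ⟨(⟨(op (diag k G E) • m).1, fun z hz => ?_⟩ : BlockModule k U), rfl⟩
      rw [op_smul_val, truncAct_diag]
      refine if_neg fun h => hz ?_
      obtain ⟨hzy, c, hc, hcz⟩ := h
      exact U.convex hc hy.1 hcz (G.le hzy)

end BlockModule

end BlockModules

/-! ### Removing a source or a sink -/

section OnePoint

variable {k : Type u} [Field k] {V : Type v} [PartialOrder V] {G : ConvexRel V} [Fintype V]

namespace TruncAlgebra

theorem one_val_self (x : V) : (1 : TruncAlgebra k G).1 x x = 1 := if_pos ⟨rfl, trivial⟩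

theorem one_val_ne {x y : V} (h : x ≠ y) : (1 : TruncAlgebra k G).1 x y = 0 :=
  if_neg fun h' => h h'.1

/-- The algebra of a one-point poset is the ground field. -/
noncomputable def algEquivOfSubsingleton [Subsingleton V] (x : V) : TruncAlgebra k G ≃ₐ[k] k :=
  AlgEquiv.ofLinearEquiv
    { toFun := fun f => f.1 x x
      invFun := fun c => c • 1
      map_add' := fun _ _ => rfl
      map_smul' := fun _ _ => rfl
      left_inv := fun f => ext_rel fun a b _ => by
        rw [Subsingleton.elim a x, Subsingleton.elim b x, smul_val, one_val_self, mul_one]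
      right_inv := fun c => (smul_val c 1 x x).trans (by rw [one_val_self, mul_one]) }
    (one_val_self (G := G) x)
    (fun f g => by
      change (f * g).1 x x = f.1 x x * g.1 x x
      rw [mul_val_of_rel _ _ (G.refl x)]
      exact Fintype.sum_eq_single x fun y hy => absurd (Subsingleton.elim y x) hy)

variable (x : V)

/-- The compression of a matrix to the vertices different from `x`. -/
noncomputable def compress (f : TruncAlgebra k G) : TruncAlgebra k (G.restrict (· ≠ x)) :=
  ⟨fun a b => f.1 a b, fun _ _ h => f.eq_zero h⟩

omit [Fintype V] in
theorem compress_val (f : TruncAlgebra k G) (a b : {v // v ≠ x}) :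
    (f.compress x).1 a b = f.1 a b := rfl

/-- The row of `x` of a matrix, without its diagonal entry. -/
noncomputable def properRow (f : TruncAlgebra k G) :
    BlockModule k ((G.row x).restrict (· ≠ x)) :=
  ⟨fun b => f.1 x b, fun _ h => f.eq_zero h⟩

omit [Fintype V] in
theorem properRow_val (f : TruncAlgebra k G) (b : {v // v ≠ x}) :
    (f.properRow x).1 b = f.1 x b := rfl

variable [Fintype {v // v ≠ x}]

omit [PartialOrder V] in
theorem sum_eq_add_sum_ne (F : V → k) : ∑ c, F c = F x + ∑ c : {v // v ≠ x}, F c := by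
  classical
  rw [Fintype.sum_eq_add_sum_subtype_ne F x]
  congr!

theorem compress_one : (1 : TruncAlgebra k G).compress x = 1 := ext_rel fun a b _ => by
  rw [compress_val]
  by_cases h : a = b
  · rw [h, one_val_self, one_val_self]
  · rw [one_val_ne h, one_val_ne fun h' => h (Subtype.ext h')]

/-- Compression loses only products passing through x, and there are none when x is a source or a
sink. -/
theorem compress_mul (h : ∀ a b, a ≠ x → b ≠ x → ¬ (G.rel a x ∧ G.rel x b))
    (f g : TruncAlgebra k G) : (f * g).compress x = f.compress x * g.compress x :=
  ext_rel fun a b hab => by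
    have hab' : G.rel a b := hab
    rw [compress_val, mul_val_of_rel f g hab', mul_val_of_rel _ _ hab, sum_eq_add_sum_ne x]
    have : f.1 a x * g.1 x b = 0 := by
      by_cases h₁ : G.rel a x
      · rw [g.eq_zero fun h₂ => h a b a.2 b.2 ⟨h₁, h₂⟩, mul_zero]
      · rw [f.eq_zero h₁, zero_mul]
    rw [this, zero_add]
    rfl

open scoped Classical in
/-- Removing a source `x` presents the algebra as a one-point extension. -/
noncomputable def algEquivOnePointExtension (hx : ∀ a, G.rel a x → a = x) :
    TruncAlgebra k G ≃ₐ[k] OnePointExtension k (TruncAlgebra k (G.restrict (· ≠ x)))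
      (BlockModule k ((G.row x).restrict (· ≠ x))) :=
  AlgEquiv.ofLinearEquiv
    { toFun := fun f => (f.compress x, f.properRow x, f.1 x x)
      invFun := fun t =>
        ⟨fun a b => if hb : b = x then (if a = x then t.2.2 else 0) else
          if ha : a = x then t.2.1.1 ⟨b, hb⟩ else t.1.1 ⟨a, ha⟩ ⟨b, hb⟩, fun a b hab => by
            dsimp only
            split_ifs with hb ha ha
            · exact absurd (ha ▸ hb ▸ G.refl x) hab
            · rfl
            · exact t.2.1.eq_zero fun h => hab (ha ▸ h)
            · exact t.1.eq_zero hab⟩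
      map_add' := fun _ _ => rfl
      map_smul' := fun _ _ => rfl
      left_inv := fun f => ext_rel fun a b hab => by
        dsimp only
        split_ifs with hb ha ha
        · rw [ha, hb]
        · exact absurd (hx a (hb ▸ hab)) ha
        · rw [properRow_val, ha]
        · rfl
      right_inv := fun t => by
        refine Prod.ext (ext_rel fun a b _ => ?_) (Prod.ext (BlockModule.ext_mem fun b _ => ?_) ?_)
        · exact (dif_neg b.2).trans (dif_neg a.2)
        · exact (dif_neg b.2).trans (dif_pos rfl)
        · exact (dif_pos rfl).trans (if_pos rfl) }
    (Prod.ext (compress_one x) (Prod.ext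
      (BlockModule.ext_mem fun b _ => one_val_ne (G := G) b.2.symm) (one_val_self (G := G) x)))
    (fun f g => by
      refine Prod.ext (compress_mul x (fun a b ha _ h => ha (hx a h.1)) f g)
        (Prod.ext (BlockModule.ext_mem fun b hb => ?_) ?_)
      · change (f * g).1 x b = truncAct _ (f.properRow x).1 (g.compress x).1 b + f.1 x x * g.1 x b
        rw [mul_val_of_rel _ _ (by exact hb), sum_eq_add_sum_ne x, add_comm, truncAct_of_mem hb]
        rfl
      · change (f * g).1 x x = f.1 x x * g.1 x x
        rw [mul_val_of_rel _ _ (G.refl x)]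
        refine Fintype.sum_eq_single x fun y hy => ?_
        rw [g.eq_zero fun h => hy (hx y h), mul_zero])

/-- The column of `x` of a matrix, without its diagonal entry, as a linear form. -/
noncomputable def properCol (f : TruncAlgebra k G) :
    Module.Dual k (BlockModule k ((G.col x).restrict (· ≠ x))) where
  toFun m := ∑ z, m.1 z * f.1 z x
  map_add' m n := by simp [add_mul, Finset.sum_add_distrib]
  map_smul' c m := by simp [Finset.mul_sum, mul_assoc]

omit [Fintype V] in
theorem properCol_apply (f : TruncAlgebra k G)
    (m : BlockModule k ((G.col x).restrict (· ≠ x))) :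
    f.properCol x m = ∑ z, m.1 z * f.1 z x := rfl

theorem _root_.BlockModule.sum_smul_single {U : G.Block} (m : BlockModule k U) :
    ∑ z, m.1 z • BlockModule.single k U z = m := BlockModule.ext_mem fun a ha => by
  have h : ∀ F : V → BlockModule k U, (∑ w, F w).1 a = ∑ w, (F w).1 a := fun F =>
    map_sum (AddMonoidHom.mk' (fun n : BlockModule k U => n.1 a) fun _ _ => rfl) F _
  rw [h, Fintype.sum_eq_single a]
  · rw [BlockModule.smul_val, BlockModule.single_self ha, mul_one]
  · intro z hz
    rw [BlockModule.smul_val]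
    exact mul_eq_zero_of_right _ (if_neg fun h' => hz h'.1.symm)

omit [Fintype V] in
theorem properCol_single (f : TruncAlgebra k G) (z : {v // v ≠ x}) :
    f.properCol x (BlockModule.single k _ z) = f.1 z x := by
  rw [properCol_apply, Fintype.sum_eq_single z]
  · by_cases hz : G.rel z x
    · rw [BlockModule.single_self (by exact hz), one_mul]
    · rw [f.eq_zero hz, mul_zero]
  · intro w hw
    exact mul_eq_zero_of_left (if_neg fun h => hw h.1) _

open scoped Classical in
/-- Removing a sink `x` presents the algebra as a one-point coextension. -/
noncomputable def algEquivOnePointCoextension (hx : ∀ a, G.rel x a → a = x) :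
    TruncAlgebra k G ≃ₐ[k] OnePointCoextension k (TruncAlgebra k (G.restrict (· ≠ x)))
      (BlockModule k ((G.col x).restrict (· ≠ x))) :=
  AlgEquiv.ofLinearEquiv
    { toFun := fun f => (f.1 x x, f.properCol x, f.compress x)
      invFun := fun t =>
        ⟨fun a b => if ha : a = x then (if b = x then t.1 else 0) else
          if hb : b = x then t.2.1 (BlockModule.single k _ ⟨a, ha⟩)
          else t.2.2.1 ⟨a, ha⟩ ⟨b, hb⟩, fun a b hab => by
            dsimp only
            split_ifs with ha hb hb
            · exact absurd (ha ▸ hb ▸ G.refl x) hab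
            · rfl
            · have : BlockModule.single k ((G.col x).restrict (· ≠ x)) ⟨a, ha⟩ = 0 :=
                BlockModule.ext_mem fun c hc => if_neg fun h => hab (by
                  have h' : G.rel c x := hc
                  rw [h.1] at h'
                  exact hb ▸ h')
              rw [this, map_zero]
            · exact t.2.2.eq_zero hab⟩
      map_add' := fun f g => Prod.ext rfl (Prod.ext (LinearMap.ext fun m => by
        change ∑ z, m.1 z * (f.1 z x + g.1 z x) = ∑ z, m.1 z * f.1 z x + ∑ z, m.1 z * g.1 z x
        simp only [mul_add, Finset.sum_add_distrib]) rfl)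
      map_smul' := fun c f => Prod.ext rfl (Prod.ext (LinearMap.ext fun m => by
        change ∑ z, m.1 z * (c * f.1 z x) = c * ∑ z, m.1 z * f.1 z x
        simp only [Finset.mul_sum, mul_left_comm]) rfl)
      left_inv := fun f => ext_rel fun a b hab => by
        dsimp only
        split_ifs with ha hb hb
        · rw [ha, hb]
        · exact absurd (hx b (ha ▸ hab)) hb
        · rw [properCol_single, hb]
        · rfl
      right_inv := fun t => by
        refine Prod.ext ?_ (Prod.ext (LinearMap.ext fun m => ?_) (ext_rel fun a b _ => ?_))
        · exact (dif_pos rfl).trans (if_pos rfl)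
        -- A linear form is recovered from its values on the basis vectors.
        · conv_rhs => rw [← BlockModule.sum_smul_single m, map_sum]
          refine Finset.sum_congr rfl fun z _ => ?_
          rw [map_smul, smul_eq_mul]
          exact congrArg (m.1 z * ·) ((dif_neg z.2).trans (dif_pos rfl))
        · exact (dif_neg a.2).trans (dif_neg b.2) }
    (Prod.ext (one_val_self (G := G) x) (Prod.ext (LinearMap.ext fun m =>
      Finset.sum_eq_zero fun z _ => mul_eq_zero_of_right _ (one_val_ne z.2)) (compress_one x)))
    (fun f g => by
      refine Prod.ext ?_ (Prod.ext (LinearMap.ext fun m => ?_)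
        (compress_mul x (fun a b _ hb h => hb (hx b h.2)) f g))
      · change (f * g).1 x x = f.1 x x * g.1 x x
        rw [mul_val_of_rel _ _ (G.refl x)]
        refine Fintype.sum_eq_single x fun y hy => ?_
        rw [f.eq_zero fun h => hy (hx y h), zero_mul]
      · change ∑ z, m.1 z * (f * g).1 z x = g.1 x x * ∑ z, m.1 z * f.1 z x +
          ∑ w : {v // v ≠ x}, truncAct _ m.1 (f.compress x).1 w * g.1 w x
        have h₁ : ∀ w : {v // v ≠ x}, truncAct ((G.col x).restrict (· ≠ x)).carrier m.1
            (f.compress x).1 w * g.1 w x = ∑ z, m.1 z * (f.1 z w * g.1 w x) := fun w => by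
          simp only [← mul_assoc, ← Finset.sum_mul]
          by_cases hw : G.rel w x
          · rw [truncAct_of_mem (by exact hw)]
            rfl
          · rw [g.eq_zero hw, mul_zero, mul_zero]
        -- For z unrelated to x the product entry is truncated, but then m vanishes at z.
        have h₂ : ∀ z : {v // v ≠ x}, m.1 z * (f * g).1 z x =
            g.1 x x * (m.1 z * f.1 z x) + ∑ w : {v // v ≠ x}, m.1 z * (f.1 z w * g.1 w x) :=
          fun z => by
            by_cases hz : G.rel z x
            · rw [mul_val_of_rel _ _ hz, sum_eq_add_sum_ne x, mul_add, Finset.mul_sum]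
              ring
            · rw [m.eq_zero hz]
              simp
        simp only [h₁, h₂, Finset.sum_add_distrib, Finset.mul_sum]
        rw [Finset.sum_comm])

end TruncAlgebra

end OnePoint

/-! ### Induction over leaves of a tree-shaped poset -/

/-- A relation on a poset shaped by a tree: adjacent vertices are related, and intervals contain
the paths of the tree between their end points. -/
structure IsTreeShaped {V : Type v} [PartialOrder V] (G : ConvexRel V) (T : SimpleGraph V) :
    Prop where
  isTree : T.IsTree
  rel_of_adj : ∀ {a b}, T.Adj a b → G.rel a b ∨ G.rel b a
  mem_Icc : ∀ {a b}, a ≤ b → ∀ p : T.Walk a b, p.IsPath → ∀ c ∈ p.support, a ≤ c ∧ c ≤ b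

namespace IsTreeShaped

variable {V : Type v} [PartialOrder V] {G : ConvexRel V} {T : SimpleGraph V}

theorem restrict (h : IsTreeShaped G T) {x y : V} (hx : ∀ z, T.Adj x z ↔ z = y) :
    IsTreeShaped (G.restrict (· ≠ x)) (T.comap (Subtype.val : {v // v ≠ x} → V)) where
  isTree := by
    classical
    have : Fintype (T.neighborSet x) :=
      Fintype.ofFinset {y} fun z => by simp [hx]
    refine ⟨h.isTree.connected.induce_compl_singleton_of_degree_eq_one (v := x)
      (SimpleGraph.degree_eq_one_iff_existsUnique_adj.2 ⟨y, (hx y).2 rfl, fun z => (hx z).1⟩),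
      h.isTree.isAcyclic.of_comap (Function.Embedding.subtype _)⟩
  rel_of_adj := fun hab => h.rel_of_adj hab
  mem_Icc := fun hab p hp c hc => by
    let f : T.comap (Subtype.val : {v // v ≠ x} → V) →g T := ⟨Subtype.val, fun h => h⟩
    have hf : Function.Injective f := Subtype.val_injective
    exact h.mem_Icc hab (p.map f) (hp.map hf) c
      (by rw [SimpleGraph.Walk.support_map]; exact List.mem_map_of_mem (f := f) hc)

/-- The first edge of any nontrivial walk from the leaf x leads to y. With `mem_Icc`, y then lies
between x and every other vertex comparable to x. -/
theorem exists_isPath_mem (h : IsTreeShaped G T) {x y : V} (hx : ∀ z, T.Adj x z ↔ z = y) {z : V}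
    (hz : z ≠ x) : ∃ p : T.Walk x z, p.IsPath ∧ y ∈ p.support := by
  obtain ⟨p, hp⟩ := h.isTree.connected.exists_isPath x z
  refine ⟨p, hp, ?_⟩
  cases p with
  | nil => exact absurd rfl hz
  | cons e q =>
    obtain rfl := (hx _).1 e
    simp

theorem mem_Icc_of_leaf_le (h : IsTreeShaped G T) {x y : V} (hx : ∀ z, T.Adj x z ↔ z = y) {z : V}
    (hz : z ≠ x) (hxz : x ≤ z) :
    x ≤ y ∧ y ≤ z := by
  obtain ⟨p, hp, hy⟩ := h.exists_isPath_mem hx hz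
  exact h.mem_Icc hxz p hp y hy

theorem mem_Icc_of_le_leaf (h : IsTreeShaped G T) {x y : V} (hx : ∀ z, T.Adj x z ↔ z = y) {z : V}
    (hz : z ≠ x) (hxz : z ≤ x) :
    z ≤ y ∧ y ≤ x := by
  obtain ⟨p, hp, hy⟩ := h.exists_isPath_mem hx hz
  exact h.mem_Icc hxz p.reverse hp.reverse y (by simpa using hy)

end IsTreeShaped

theorem IsTreeShaped.isAccessible (k : Type u) [Field k] (n : ℕ) :
    ∀ (V : Type v) [PartialOrder V] [Fintype V] (G : ConvexRel V) (T : SimpleGraph V),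
      Fintype.card V = n → IsTreeShaped G T → IsAccessible k (TruncAlgebra k G) := by
  classical
  induction n with
  | zero =>
    intro V _ _ G T hn hT
    have := hT.isTree.connected.nonempty
    exact absurd hn Fintype.card_ne_zero
  | succ n ih =>
    intro V _ _ G T hn hT
    obtain ⟨x₀⟩ := hT.isTree.connected.nonempty
    rcases subsingleton_or_nontrivial V with hV | hV
    · exact .base _ (TruncAlgebra.algEquivOfSubsingleton x₀)
    obtain ⟨x, hx⟩ := hT.isTree.exists_vert_degree_one_of_nontrivial
    obtain ⟨y, hxy, hy⟩ := SimpleGraph.degree_eq_one_iff_existsUnique_adj.1 hx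
    have hadj : ∀ z, T.Adj x z ↔ z = y := fun z => ⟨hy z, fun h => h ▸ hxy⟩
    have hB := ih {v // v ≠ x} (G.restrict (· ≠ x)) _ (by simp [hn]) (hT.restrict hadj)
    rcases hT.rel_of_adj hxy with h | h
    -- Another vertex below x would give y ≤ x, while the edge gives x ≤ y.
    · have hsrc : ∀ a, G.rel a x → a = x := fun a ha => by
        by_contra hax
        exact hxy.ne (le_antisymm (G.le h) (hT.mem_Icc_of_le_leaf hadj hax (G.le ha)).2)
      have hex := BlockModule.isExceptional_of_isLeast (k := k)
        (U := (G.row x).restrict (· ≠ x)) (y := ⟨y, hxy.ne'⟩)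
        ⟨h, fun z hz => (hT.mem_Icc_of_leaf_le hadj z.2 (G.le hz)).2⟩
      exact .extension _ hB _ hex _ (TruncAlgebra.algEquivOnePointExtension x hsrc)
    · have hsink : ∀ a, G.rel x a → a = x := fun a ha => by
        by_contra hax
        exact hxy.ne (le_antisymm (hT.mem_Icc_of_leaf_le hadj hax (G.le ha)).1 (G.le h))
      have hex := BlockModule.isExceptional_of_isGreatest (k := k)
        (U := (G.col x).restrict (· ≠ x)) (y := ⟨y, hxy.ne'⟩)
        ⟨h, fun z hz => (hT.mem_Icc_of_le_leaf hadj z.2 (G.le hz)).1⟩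
      exact .coextension _ hB _ hex _ (TruncAlgebra.algEquivOnePointCoextension x hsink)

/-! ### Directed paths in a tree quiver -/

namespace IsTreeQuiver

variable {V : Type v} [Quiver.{w} V]

/-- The underlying graph of a quiver. -/
abbrev underlyingGraph (V : Type v) [Quiver.{w} V] : SimpleGraph V :=
  SimpleGraph.fromRel fun a b : V => Nonempty (a ⟶ b)

variable (hV : IsTreeQuiver V)
include hV

theorem adj {a b : V} (e : a ⟶ b) : (underlyingGraph V).Adj a b :=
  ⟨fun h => by subst h; exact hV.not_both a a ⟨e⟩ ⟨e⟩, Or.inl ⟨e⟩⟩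

/-- The walk in the underlying graph given by a path. -/
noncomputable def toWalk {a : V} : ∀ {b : V}, Quiver.Path a b → (underlyingGraph V).Walk a b
  | _, .nil => .nil
  | _, .cons p e => (toWalk p).concat (hV.adj e)

theorem toWalk_cons {a b c : V} (p : Quiver.Path a b) (e : b ⟶ c) :
    hV.toWalk (p.cons e) = (hV.toWalk p).concat (hV.adj e) := rfl

/-- In a forest a path extended by an edge can revisit a vertex only by backtracking, and
backtracking would need two opposite arrows, which `not_both` forbids. -/
theorem toWalk_isPath {a b : V} (p : Quiver.Path a b) : (hV.toWalk p).IsPath := by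
  induction p with
  | nil => exact SimpleGraph.Walk.IsPath.nil
  | cons p e ih =>
    refine ih.concat (fun hc => ?_) (hV.adj e)
    have := hV.isTree.isAcyclic.eq_penultimate_of_adj_end ih (hV.adj e) hc
    cases p with
    | nil => exact (hV.adj e).ne this.symm
    | cons q f =>
      rw [toWalk_cons, SimpleGraph.Walk.penultimate_concat] at this
      subst this
      exact hV.not_both _ _ ⟨e⟩ ⟨f⟩

theorem toWalk_injective {a b : V} (p q : Quiver.Path a b) (h : hV.toWalk p = hV.toWalk q) :
    p = q := by
  induction p with
  | nil =>
    cases q with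
    | nil => rfl
    | cons q f => exact absurd h.symm (SimpleGraph.Walk.concat_ne_nil _ _)
  | cons p e ih =>
    cases q with
    | nil => exact absurd h (SimpleGraph.Walk.concat_ne_nil _ _)
    | cons q f =>
      obtain ⟨hv, hp⟩ := SimpleGraph.Walk.concat_inj h
      subst hv
      rw [ih q hp, (hV.subsingleton_hom _ _).elim e f]

/-- Directed paths inject into the paths of the underlying tree, which are unique. -/
theorem subsingleton_path (a b : V) : Subsingleton (Quiver.Path a b) :=
  ⟨fun p q => hV.toWalk_injective p q (congrArg Subtype.val
    ((hV.isTree.isAcyclic.subsingleton_path a b).elim ⟨_, hV.toWalk_isPath p⟩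
      ⟨_, hV.toWalk_isPath q⟩))⟩

theorem exists_path_of_mem_support {a b : V} (p : Quiver.Path a b) {c : V}
    (hc : c ∈ (hV.toWalk p).support) :
    Nonempty (Quiver.Path a c) ∧ Nonempty (Quiver.Path c b) := by
  induction p with
  | nil =>
    obtain rfl : c = a := by simpa [toWalk] using hc
    exact ⟨⟨.nil⟩, ⟨.nil⟩⟩
  | @cons b' d p e ih =>
    rw [toWalk_cons, SimpleGraph.Walk.support_concat, List.mem_append,
      List.mem_singleton] at hc
    rcases hc with hc | rfl
    · exact ⟨(ih hc).1, (ih hc).2.map fun q => q.cons e⟩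
    · exact ⟨⟨p.cons e⟩, ⟨.nil⟩⟩

/-- The vertices of a tree quiver, lifted to a larger universe and ordered by reachability. -/
abbrev pathOrder : PartialOrder (ULift.{w} V) where
  le a b := Nonempty (Quiver.Path a.down b.down)
  le_refl a := ⟨.nil⟩
  le_trans a b c := fun ⟨p⟩ ⟨q⟩ => ⟨p.comp q⟩
  le_antisymm a b := fun ⟨p⟩ ⟨q⟩ => ULift.ext _ _ <| by
    -- A closed directed path equals the trivial one, so p has length zero.
    have h := congrArg Quiver.Path.length ((hV.subsingleton_path _ _).elim (p.comp q) .nil)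
    rw [Quiver.Path.length_comp, Quiver.Path.length_nil] at h
    exact Quiver.Path.eq_of_length_zero p (by omega)

end IsTreeQuiver

/-! ### The relation defined by the zero relations -/

/-- A path avoids `R` if no path in `R` occurs in it. -/
def Quiver.Path.Avoids {V : Type v} [Quiver.{w} V] (R : ∀ a b : V, Set (Quiver.Path a b))
    {a b : V} (p : Quiver.Path a b) : Prop :=
  ∀ (c d : V) (q : Quiver.Path a c) (r : Quiver.Path c d) (s : Quiver.Path d b),
    p = q.comp (r.comp s) → r ∉ R c d

section

variable {V : Type v} [Quiver.{w} V] {R : ∀ a b : V, Set (Quiver.Path a b)}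

theorem Quiver.Path.Avoids.left {a b c : V} {p : Quiver.Path a b} {q : Quiver.Path b c}
    (h : (p.comp q).Avoids R) : p.Avoids R := fun d e q' r s hp =>
  h d e q' r (s.comp q) (by rw [hp]; simp only [Quiver.Path.comp_assoc])

theorem Quiver.Path.Avoids.right {a b c : V} {p : Quiver.Path a b} {q : Quiver.Path b c}
    (h : (p.comp q).Avoids R) : q.Avoids R := fun d e q' r s hp =>
  h d e (p.comp q') r s (by rw [hp]; simp only [Quiver.Path.comp_assoc])

/-- The length bound on zero relations enters here: it keeps trivial paths and arrows nonzero, which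
makes the relation reflexive and adjacent vertices related. -/
theorem Quiver.Path.avoids_of_length_le_one
    (hR : ∀ (a b : V) (p : Quiver.Path a b), p ∈ R a b → 2 ≤ p.length)
    {a b : V} {p : Quiver.Path a b} (hp : p.length ≤ 1) : p.Avoids R := fun c d q r s h hr => by
  have := hR c d r hr
  rw [h, Quiver.Path.length_comp, Quiver.Path.length_comp] at hp
  omega

variable (hV : IsTreeQuiver V)

namespace IsTreeQuiver

/-- Two vertices are related if there is a path from the first to the second that avoids the
zero relations. -/
def pathRel (hR : ∀ (a b : V) (p : Quiver.Path a b), p ∈ R a b → 2 ≤ p.length) :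
    letI := hV.pathOrder
    ConvexRel (ULift.{w} V) :=
  letI := hV.pathOrder
  { rel := fun a b => ∃ p : Quiver.Path a.down b.down, p.Avoids R
    refl := fun a => ⟨.nil, Quiver.Path.avoids_of_length_le_one hR (Nat.zero_le 1)⟩
    le := fun ⟨p, _⟩ => ⟨p⟩
    -- By uniqueness p is the concatenation of q and r, and subpaths inherit avoidance.
    left := fun {a b c} ⟨p, hp⟩ ⟨q⟩ ⟨r⟩ => ⟨q, by
      rw [(hV.subsingleton_path _ _).elim p (q.comp r)] at hp
      exact hp.left⟩
    right := fun {a b c} ⟨p, hp⟩ ⟨q⟩ ⟨r⟩ => ⟨r, by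
      rw [(hV.subsingleton_path _ _).elim p (q.comp r)] at hp
      exact hp.right⟩ }

theorem isTreeShaped (hR : ∀ (a b : V) (p : Quiver.Path a b), p ∈ R a b → 2 ≤ p.length) :
    letI := hV.pathOrder
    IsTreeShaped (hV.pathRel hR) ((underlyingGraph V).comap (ULift.down : ULift.{w} V → V)) := by
  let := hV.pathOrder
  refine ⟨?_, ?_, ?_⟩
  · exact (SimpleGraph.Iso.comap Equiv.ulift (underlyingGraph V)).isTree_iff.2 hV.isTree
  · intro a b hab
    rcases hab.2 with ⟨⟨e⟩⟩ | ⟨⟨e⟩⟩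
    · exact Or.inl ⟨e.toPath, Quiver.Path.avoids_of_length_le_one hR le_rfl⟩
    · exact Or.inr ⟨e.toPath, Quiver.Path.avoids_of_length_le_one hR le_rfl⟩
  · rintro a b ⟨P⟩ p hp c hc
    let f : (underlyingGraph V).comap (ULift.down : ULift.{w} V → V) →g underlyingGraph V :=
      ⟨ULift.down, fun h => h⟩
    have hf : Function.Injective f := ULift.down_injective
    -- Uniqueness in the tree identifies p with the walk of the directed path P, whose vertices are
    -- reachable from a and reach b.
    have h : p.map f = hV.toWalk P := congrArg Subtype.val
      ((hV.isTree.isAcyclic.subsingleton_path a.down b.down).elim ⟨_, hp.map hf⟩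
        ⟨_, hV.toWalk_isPath P⟩)
    refine hV.exists_path_of_mem_support P (c := c.down) ?_
    rw [← h, SimpleGraph.Walk.support_map]
    exact List.mem_map_of_mem (f := f) hc

end IsTreeQuiver

end

/-! ### From the path algebra to matrices -/

namespace PathAlgebra

variable {k : Type u} [Field k] {V : Type v} [Quiver.{w} V]

/-- The sum of the coefficients of a combination of paths. -/
noncomputable def coeffSum (a b : V) : (Quiver.Path a b →₀ k) →ₗ[k] k :=
  Finsupp.linearCombination k fun _ => (1 : k)

theorem coeffSum_single {a b : V} (p : Quiver.Path a b) (r : k) :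
    coeffSum a b (Finsupp.single p r) = r := by
  simp [coeffSum]

theorem coeffSum_concat (a b c : V) (x : Quiver.Path a b →₀ k) (y : Quiver.Path b c →₀ k) :
    coeffSum a c (concat a b c x y) = coeffSum a b x * coeffSum b c y := by
  induction x using Finsupp.induction_linear with
  | zero => simp
  | add x₁ x₂ h₁ h₂ => simp [h₁, h₂, add_mul]
  | single p r =>
    induction y using Finsupp.induction_linear with
    | zero => simp
    | add y₁ y₂ h₁ h₂ => simp only [map_add, h₁, h₂, mul_add]
    | single q s => simp only [concat_single, coeffSum_single]

theorem coeffSum_of_isEmpty {a b : V} (h : IsEmpty (Quiver.Path a b)) (x : Quiver.Path a b →₀ k) :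
    coeffSum a b x = 0 := by
  rw [Subsingleton.elim x 0, map_zero]

variable [DecidableEq V]

theorem ofPath_apply_self {a b : V} (p : Quiver.Path a b) :
    ofPath k p a b = Finsupp.single p 1 := by
  simp [ofPath]

theorem ofPath_apply_of_ne {a b : V} (p : Quiver.Path a b) {c d : V} (h : ¬ (c = a ∧ d = b)) :
    ofPath k p c d = 0 := by
  by_cases hc : c = a
  · subst hc
    have hd : d ≠ b := fun hd => h ⟨rfl, hd⟩
    simp [ofPath, hd]
  · simp [ofPath, hc]

theorem eq_sum_single [Fintype V] (x : PathAlgebra k V) :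
    x = ∑ a, ∑ b, (Pi.single a (Pi.single b (x a b)) : PathAlgebra k V) := by
  refine (Finset.univ_sum_single (M := fun a => ∀ b : V, Quiver.Path a b →₀ k) x).symm.trans ?_
  refine Finset.sum_congr rfl fun a _ => ?_
  conv_lhs => rw [← Finset.univ_sum_single (x a)]
  exact map_sum (AddMonoidHom.single (fun a => ∀ b : V, Quiver.Path a b →₀ k) a) _ _

variable [Fintype V]

theorem ofPath_mul_ofPath {a b c : V} (p : Quiver.Path a b) (q : Quiver.Path b c) :
    ofPath k p * ofPath k q = ofPath k (p.comp q) := by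
  funext d e
  rw [mul_apply, Fintype.sum_eq_single b]
  · by_cases hd : d = a
    · by_cases he : e = c
      · subst hd he
        rw [ofPath_apply_self, ofPath_apply_self, ofPath_apply_self, concat_single, mul_one]
      · rw [ofPath_apply_of_ne q fun h => he h.2, ofPath_apply_of_ne _ fun h => he h.2, map_zero]
    · rw [ofPath_apply_of_ne p fun h => hd h.1, ofPath_apply_of_ne _ fun h => hd h.1, map_zero,
        LinearMap.zero_apply]
  · intro f hf
    rw [ofPath_apply_of_ne p fun h => hf h.2, map_zero, LinearMap.zero_apply]

/-- Writing the scalar as a left factor in the ring lets closure of an ideal under multiplication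
absorb it. -/
theorem single_single_eq {a b : V} (p : Quiver.Path a b) (c : k) :
    (Pi.single a (Pi.single b (Finsupp.single p c)) : PathAlgebra k V) =
      (c • 1 : PathAlgebra k V) * ofPath k p := by
  rw [smul_mul_assoc, one_mul, ofPath]
  refine Eq.trans ?_ (Pi.single_smul (f := fun a => ∀ b : V, Quiver.Path a b →₀ k) a c
    (Pi.single b (Finsupp.single p 1)))
  rw [← Pi.single_smul, Finsupp.smul_single, smul_eq_mul, mul_one]

end PathAlgebra

namespace IsTreeQuiver

open PathAlgebra

variable (k : Type u) [Field k] {V : Type v} [Quiver.{w} V] [Fintype V] [DecidableEq V]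
  (hV : IsTreeQuiver V) {R : ∀ a b : V, Set (Quiver.Path a b)}
  (hR : ∀ (a b : V) (p : Quiver.Path a b), p ∈ R a b → 2 ≤ p.length)

open scoped Classical in
/-- The underlying function of `IsTreeQuiver.pathAlgebraHom`. -/
noncomputable def pathAlgebraFun (x : PathAlgebra k V) :
    letI := hV.pathOrder
    TruncAlgebra k (hV.pathRel hR) :=
  ⟨fun a b => if ∃ p : Quiver.Path a.down b.down, p.Avoids R then
    coeffSum a.down b.down (x a.down b.down) else 0,
    fun _ _ h => if_neg h⟩

omit [Fintype V] [DecidableEq V] in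
theorem pathAlgebraFun_val (x : PathAlgebra k V) {a b : ULift.{w} V}
    (h : ∃ p : Quiver.Path a.down b.down, p.Avoids R) :
    letI := hV.pathOrder
    (hV.pathAlgebraFun k hR x).1 a b = coeffSum a.down b.down (x a.down b.down) := if_pos h

/-- At an entry (a, c) with an avoiding path, compare the terms of a middle vertex b. If b is not on
the way from a to c, both vanish; otherwise both halves of the path avoid the relations, and neither
factor is truncated. -/
theorem pathAlgebraFun_mul (x y : PathAlgebra k V) :
    letI := hV.pathOrder
    hV.pathAlgebraFun k hR (x * y) = hV.pathAlgebraFun k hR x * hV.pathAlgebraFun k hR y := by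
  let := hV.pathOrder
  refine TruncAlgebra.ext_rel fun a c h => ?_
  rw [pathAlgebraFun_val k hV hR _ h, TruncAlgebra.mul_val_of_rel _ _ h, mul_apply, map_sum]
  refine Fintype.sum_equiv Equiv.ulift.{w}.symm _ _ fun b => ?_
  rw [coeffSum_concat]
  have aux : ∀ {z : PathAlgebra k V} {d e : ULift.{w} V},
      IsEmpty (Quiver.Path d.down e.down) → (hV.pathAlgebraFun k hR z).1 d e = 0 :=
    fun {z d e} hde => (hV.pathAlgebraFun k hR z).eq_zero fun ⟨p, _⟩ => hde.elim p
  rcases isEmpty_or_nonempty (Quiver.Path a.down b) with h₁ | h₁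
  · rw [coeffSum_of_isEmpty h₁, aux (e := Equiv.ulift.symm b) h₁, zero_mul, zero_mul]
  · rcases isEmpty_or_nonempty (Quiver.Path b c.down) with h₂ | h₂
    · rw [coeffSum_of_isEmpty h₂, aux (d := Equiv.ulift.symm b) h₂, mul_zero, mul_zero]
    · rw [pathAlgebraFun_val k hV hR x (b := Equiv.ulift.symm b)
        ((hV.pathRel hR).left h h₁ h₂), pathAlgebraFun_val k hV hR y (a := Equiv.ulift.symm b)
        ((hV.pathRel hR).right h h₁ h₂)]
      rfl

/-- The map from the path algebra of a tree quiver that sends each path avoiding the zero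
relations to the matrix unit of its end points, and all other paths to zero. -/
noncomputable def pathAlgebraHom :
    letI := hV.pathOrder
    PathAlgebra k V →ₐ[k] TruncAlgebra k (hV.pathRel hR) :=
  letI := hV.pathOrder
  AlgHom.ofLinearMap
    { toFun := hV.pathAlgebraFun k hR
      map_add' := fun x y => TruncAlgebra.ext_rel fun a b h => by
        rw [TruncAlgebra.add_val, pathAlgebraFun_val k hV hR _ h, pathAlgebraFun_val k hV hR _ h,
          pathAlgebraFun_val k hV hR _ h]
        exact map_add (coeffSum a.down b.down) _ _
      map_smul' := fun c x => TruncAlgebra.ext_rel fun a b h => by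
        rw [RingHom.id_apply, TruncAlgebra.smul_val, pathAlgebraFun_val k hV hR _ h,
          pathAlgebraFun_val k hV hR _ h]
        exact map_smul (coeffSum a.down b.down) _ _ }
    (TruncAlgebra.ext_rel fun a b h => by
      refine (pathAlgebraFun_val k hV hR 1 h).trans ?_
      rw [one_apply]
      by_cases hab : a = b
      · subst hab
        rw [Pi.single_eq_same, coeffSum_single, TruncAlgebra.one_val_self]
      · rw [Pi.single_eq_of_ne fun h => hab (ULift.ext _ _ h.symm), map_zero,
          TruncAlgebra.one_val_ne hab])
    (hV.pathAlgebraFun_mul k hR)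

theorem pathAlgebraHom_val (x : PathAlgebra k V) {a b : ULift.{w} V}
    (h : ∃ p : Quiver.Path a.down b.down, p.Avoids R) :
    letI := hV.pathOrder
    (hV.pathAlgebraHom k hR x).1 a b = coeffSum a.down b.down (x a.down b.down) := if_pos h

theorem pathAlgebraHom_surjective : Function.Surjective (hV.pathAlgebraHom k hR) := by
  classical
  let := hV.pathOrder
  intro f
  refine ⟨fun a b => if h : ∃ p : Quiver.Path a b, p.Avoids R then
    Finsupp.single h.choose (f.1 ⟨a⟩ ⟨b⟩) else 0, TruncAlgebra.ext_rel fun a b h => ?_⟩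
  refine (pathAlgebraHom_val k hV hR _ h).trans ?_
  refine (congrArg (coeffSum a.down b.down) (dif_pos h)).trans ?_
  rw [coeffSum_single]

theorem pathAlgebraHom_ofPath {a b : V} (p : Quiver.Path a b) (hp : ¬ p.Avoids R) :
    hV.pathAlgebraHom k hR (ofPath k p) = 0 := by
  let := hV.pathOrder
  refine TruncAlgebra.ext_rel fun c d h => (pathAlgebraHom_val k hV hR _ h).trans ?_
  by_cases hcd : c.down = a ∧ d.down = b
  · obtain ⟨c⟩ := c
    obtain ⟨d⟩ := d
    obtain ⟨rfl, rfl⟩ := hcd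
    obtain ⟨q, hq⟩ := h
    exact absurd ((hV.subsingleton_path _ _).elim q p ▸ hq) hp
  · rw [ofPath_apply_of_ne p hcd, map_zero]
    rfl

theorem ofPath_mem_zeroRelationIdeal {a b : V} {p : Quiver.Path a b} (hp : ¬ p.Avoids R) :
    ofPath k p ∈ zeroRelationIdeal k R := by
  simp only [Quiver.Path.Avoids, not_forall, not_not] at hp
  obtain ⟨c, d, q, r, s, rfl, hr⟩ := hp
  rw [← ofPath_mul_ofPath, ← ofPath_mul_ofPath]
  exact TwoSidedIdeal.mul_mem_left _ _ _ (TwoSidedIdeal.mul_mem_right _ _ _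
    (TwoSidedIdeal.subset_span ⟨c, d, r, hr, rfl⟩))

/-- Each component of x is a multiple of a single path. For an element of the kernel the coefficient
is zero when that path avoids the relations; otherwise the path contains a generator and lies in the
ideal. -/
theorem zeroRelationIdeal_eq_ker :
    zeroRelationIdeal k R = TwoSidedIdeal.ker (hV.pathAlgebraHom k hR) := by
  let := hV.pathOrder
  refine le_antisymm (TwoSidedIdeal.span_le.2 ?_) fun x hx => ?_
  · rintro _ ⟨a, b, p, hp, rfl⟩
    refine (TwoSidedIdeal.mem_ker _).2 (hV.pathAlgebraHom_ofPath k hR p fun h => ?_)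
    exact h a b .nil p .nil (by simp) hp
  · have hx : hV.pathAlgebraHom k hR x = 0 := (TwoSidedIdeal.mem_ker _).1 hx
    rw [eq_sum_single x]
    refine sum_mem fun a _ => sum_mem fun b _ => ?_
    have hsub := hV.subsingleton_path a b
    rcases isEmpty_or_nonempty (Quiver.Path a b) with h | ⟨⟨p⟩⟩
    · rw [Subsingleton.elim (x a b) 0, Pi.single_zero, Pi.single_zero]
      exact TwoSidedIdeal.zero_mem _
    · have hxp : x a b = Finsupp.single p (x a b p) := Finsupp.ext fun q => by
        rw [hsub.elim q p, Finsupp.single_eq_same]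
      by_cases hp : p.Avoids R
      · have h₀ : (hV.pathAlgebraHom k hR x).1 ⟨a⟩ ⟨b⟩ = 0 := by rw [hx]; rfl
        rw [pathAlgebraHom_val k hV hR x ⟨p, hp⟩, hxp, coeffSum_single] at h₀
        rw [hxp, h₀, Finsupp.single_zero, Pi.single_zero, Pi.single_zero]
        exact TwoSidedIdeal.zero_mem _
      · rw [hxp, single_single_eq]
        exact TwoSidedIdeal.mul_mem_left _ _ _ (ofPath_mem_zeroRelationIdeal k hp)

/-- A tree algebra is the truncated incidence algebra of its reachability order. -/
noncomputable def algEquivTruncAlgebra :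
    letI := hV.pathOrder
    ZeroRelationAlgebra k V R ≃ₐ[k] TruncAlgebra k (hV.pathRel hR) :=
  letI := hV.pathOrder
  have h : (zeroRelationIdeal k R).ringCon = RingCon.ker (hV.pathAlgebraHom k hR).toRingHom := by
    rw [hV.zeroRelationIdeal_eq_ker k hR]
    rfl
  AlgEquiv.ofBijective (RingCon.liftₐ _ (hV.pathAlgebraHom k hR) h.le)
    (RingCon.lift_bijective_iff.2 ⟨h, hV.pathAlgebraHom_surjective k hR⟩)

end IsTreeQuiver

/-! ### Conclusion -/

theorem IsAccessible.of_algEquiv {k : Type u} [Field k] {A B : Type v} [Ring A] [Algebra k A]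
    [Ring B] [Algebra k B] (hA : IsAccessible k A) (e : B ≃ₐ[k] A) : IsAccessible k B := by
  cases hA with
  | base _ e' => exact .base B (e.trans e')
  | extension B' hB M hM _ e' => exact .extension B' hB M hM B (e.trans e')
  | coextension B' hB M hM _ e' => exact .coextension B' hB M hM B (e.trans e')

theorem mainTheorem10 (k : Type u) [Field k] (V : Type v) [Fintype V] [DecidableEq V]
    [Quiver.{w} V] (hV : IsTreeQuiver V)
    (R : ∀ a b : V, Set (Quiver.Path a b))
    (hR : ∀ (a b : V) (p : Quiver.Path a b), p ∈ R a b → 2 ≤ p.length) :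
    IsAccessible k (ZeroRelationAlgebra k V R) := by
  -- The order lives on `ULift V`, which puts the matrix algebra in the universe of the quotient, as
  -- `of_algEquiv` requires.
  let := hV.pathOrder
  exact ((hV.isTreeShaped hR).isAccessible k _ _ _ _ rfl).of_algEquiv
    (hV.algEquivTruncAlgebra k hR)
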